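/- **Theorem 1 (Non-computable asymptotic normality of $C$ statistics).** Fix $d\ge 0$, a parameter set $\Theta\subseteq\mathbb{R}^d$ and a true value $\theta^\star$ in the interior of $\Theta$. For each number of bins $n$ let $N_1,\dots,N_n$ be the observed counts and let $s_1,\dots,s_n\ge 0$ be known rate functions of $\theta$ (they may depend on the binning, i.e. $s_i=s_{n,i}$). Assume $H_0$: under $P_{\theta}$ the $N_i$ are independent with $N_i\sim\mathrm{Poisson}(s_i(\theta))$, and the data are generated under $P_{\theta^\star}$. Assume that $s_i(\theta^\star)\le M$ for some constant $M$ and all $n,i$, and that the $s_i$ are differentiable at $\theta^\star$ uniformly over all $n$ and $i\le n$: $$\lim_{\theta\to\theta^\star}\ \sup_{n}\ \sup_{i\le n}\frac{|s_i(\theta)-s_i(\theta^\star)-\nabla s_i(\theta^\star)^\top(\theta-\theta^\star)|}{\|\theta-\theta^\star\|}=0 .$$ Let $$C_n(\theta)=2\sum_{i=1}^n\left[s_i(\theta)-N_i\log s_i(\theta)-N_i+N_i\log N_i\right]\qquad(0\log 0=0),$$ and let $\hat\theta=\hat\theta_n$ be a maximum likelihood estimator, i.e. for every data vector a maximizer over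 $\Theta$ of the Poisson likelihood. Let $\ell(\theta)$ be the log-likelihood, $D\ell$ its gradient, $I_n(\theta)=\frac1n\mathrm{Cov}_\theta(D\ell(\theta))$, and suppose that $I(\theta^\star)=\lim_{n\to\infty}I_n(\theta^\star)$ exists and is positive definite. Assume Regularity Conditions (B): (B1) $\sqrt n(\hat\theta-\theta^\star)\to N(0,I^{-1}(\theta^\star))$ in distribution under $P_{\theta^\star}$ as $n\to\infty$; (B2) there is $\epsilon>0$ with $s_i(\theta)\ge\epsilon$ for all $n$, all $i\le n$ and all $\theta\in\Theta$. Then $C_n(\theta^\star)$ and $C_n(\hat\theta)$ are square integrable under $P_{\theta^\star}$ for every $n$, and as $n\to\infty$, in distribution under $P_{\theta^\star}$, $$\text{(i)}\quad\frac{C_n(\theta^\star)-\mathbb{E}_{\theta^\star}[C_n(\theta^\star)]}{\sqrt{\mathrm{Var}_{\theta^\star}[C_n(\theta^\star)]}}\to N(0,1),\qquad \text{(ii)}\quad\frac{C_n(\hat\theta)-\mathbb{E}_{\theta^\star}[C_n(\hat\theta)]}{\sqrt{\mathrm{Var}_{\theta^\star}[C_n(\hat\theta)]}}\to N(0,1).$$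 -/

import Mathlib

open MeasureTheory ProbabilityTheory Filter Topology
open scoped NNReal

noncomputable section

namespace PoissonBins

variable {d n : ℕ}

/-- Joint law `P_θ` of the counts `(N_1, …, N_n)`: independent Poisson variables, the `i`-th one
with rate `s_i(θ)`. -/
def countLaw (s : Fin n → EuclideanSpace ℝ (Fin d) → ℝ≥0) (θ : EuclideanSpace ℝ (Fin d)) :
    Measure (Fin n → ℕ) :=
  Measure.pi fun i => poissonMeasure (s i θ)

instance (s : Fin n → EuclideanSpace ℝ (Fin d) → ℝ≥0) (θ : EuclideanSpace ℝ (Fin d)) :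
    IsProbabilityMeasure (countLaw s θ) :=
  inferInstanceAs (IsProbabilityMeasure (Measure.pi fun i => poissonMeasure (s i θ)))

/-- Poisson probability mass function `f(k) = e^{-r} r^k / k!`. -/
def pmf (r : ℝ≥0) (k : ℕ) : ℝ := Real.exp (-(r : ℝ)) * (r : ℝ) ^ k / (k.factorial : ℝ)

/-- The likelihood of `θ` given the counts `N`. -/
def likelihood (s : Fin n → EuclideanSpace ℝ (Fin d) → ℝ≥0) (θ : EuclideanSpace ℝ (Fin d))
    (N : Fin n → ℕ) : ℝ :=
  ∏ i, pmf (s i θ) (N i)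

/-- The log-likelihood `ℓ(θ) = ∑ log f_i(N_i ∣ θ)`. -/
def logLikelihood (s : Fin n → EuclideanSpace ℝ (Fin d) → ℝ≥0) (θ : EuclideanSpace ℝ (Fin d))
    (N : Fin n → ℕ) : ℝ :=
  ∑ i, Real.log (pmf (s i θ) (N i))

/-- The score `Dℓ(θ)`, the gradient of the log-likelihood in `θ`. -/
def score (s : Fin n → EuclideanSpace ℝ (Fin d) → ℝ≥0) (θ : EuclideanSpace ℝ (Fin d))
    (N : Fin n → ℕ) : EuclideanSpace ℝ (Fin d) :=
  gradient (fun t => logLikelihood s t N) θ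

/-- The normalized information matrix `I_n(θ) = (1/n) Cov_θ(Dℓ(θ))`. -/
def fisherInfo (s : Fin n → EuclideanSpace ℝ (Fin d) → ℝ≥0) (θ : EuclideanSpace ℝ (Fin d)) :
    Matrix (Fin d) (Fin d) ℝ :=
  Matrix.of fun a b =>
    (1 / (n : ℝ)) * cov[fun N => score s θ N a, fun N => score s θ N b; countLaw s θ]

/-- `θhat` is a maximum likelihood estimator over the parameter set `Θ`. -/
def IsMLE (Θ : Set (EuclideanSpace ℝ (Fin d))) (s : Fin n → EuclideanSpace ℝ (Fin d) → ℝ≥0)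
    (θhat : (Fin n → ℕ) → EuclideanSpace ℝ (Fin d)) : Prop :=
  ∀ N, θhat N ∈ Θ ∧ ∀ θ ∈ Θ, likelihood s θ N ≤ likelihood s (θhat N) N

/-- The `C` function
`C_n(θ) = 2 ∑ [s_i(θ) - N_i log s_i(θ) - N_i + N_i log N_i]`, with `0 log 0 = 0`. -/
def cFun (s : Fin n → EuclideanSpace ℝ (Fin d) → ℝ≥0) (θ : EuclideanSpace ℝ (Fin d))
    (N : Fin n → ℕ) : ℝ :=
  2 * ∑ i, ((s i θ : ℝ) - (N i : ℝ) * Real.log (s i θ : ℝ) - (N i : ℝ)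
    + (N i : ℝ) * Real.log (N i : ℝ))

/-- A random variable centred by its mean and divided by its standard deviation under `μ`. -/
def standardize {Ω : Type*} [MeasurableSpace Ω] (X : Ω → ℝ) (μ : Measure Ω) (ω : Ω) : ℝ :=
  (X ω - ∫ ω', X ω' ∂μ) / Real.sqrt (Var[X; μ])

/-- The rate functions are differentiable at `θ₀`, uniformly over all bins of all the binnings. -/
def UniformlyDifferentiableAt (s : (n : ℕ) → Fin n → EuclideanSpace ℝ (Fin d) → ℝ≥0)
    (θ₀ : EuclideanSpace ℝ (Fin d)) : Prop :=
  ∃ G : (n : ℕ) → Fin n → EuclideanSpace ℝ (Fin d),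
    ∀ c > 0, ∃ r > 0, ∀ (n : ℕ) (i : Fin n) (θ : EuclideanSpace ℝ (Fin d)), ‖θ - θ₀‖ < r →
      |(s n i θ : ℝ) - (s n i θ₀ : ℝ) - inner ℝ (G n i) (θ - θ₀)| ≤ c * ‖θ - θ₀‖

end PoissonBins

end

noncomputable section

namespace EfronStein

variable {α : Type*} [MeasurableSpace α] {n : ℕ}

/-- The sample with coordinates in `s` taken from the second copy. -/
def mix (p : Fin n → Prop) [DecidablePred p] (z : Fin n → α × α) : Fin n → α :=
  fun j => if p j then (z j).2 else (z j).1

/-- Exchange of the two copies in the coordinates satisfying `p`. -/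
def swapOn (p : Fin n → Prop) [DecidablePred p] (z : Fin n → α × α) : Fin n → α × α :=
  fun j => if p j then (z j).swap else z j

variable (μ : Fin n → Measure α) [∀ i, IsProbabilityMeasure (μ i)]

/-- Two independent copies of the sample, stored coordinatewise. -/
def twoCopies : Measure (Fin n → α × α) := Measure.pi fun i => (μ i).prod (μ i)

instance : IsProbabilityMeasure (twoCopies μ) :=
  inferInstanceAs (IsProbabilityMeasure (Measure.pi fun i => (μ i).prod (μ i)))

lemma measurePreserving_mix (p : Fin n → Prop) [DecidablePred p] :
    MeasurePreserving (mix p) (twoCopies μ) (Measure.pi μ) := by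
  have h := measurePreserving_pi (fun i => (μ i).prod (μ i)) μ
    (f := fun j (w : α × α) => if p j then w.2 else w.1) (fun j => by
      by_cases hj : p j
      · simpa [hj] using (measurePreserving_snd (μ := μ j) (ν := μ j))
      · simpa [hj] using (measurePreserving_fst (μ := μ j) (ν := μ j)))
  exact h

lemma measurePreserving_swapOn (p : Fin n → Prop) [DecidablePred p] :
    MeasurePreserving (swapOn p) (twoCopies μ) (twoCopies μ) := by
  have h := measurePreserving_pi (fun i => (μ i).prod (μ i)) (fun i => (μ i).prod (μ i))
    (f := fun j (w : α × α) => if p j then w.swap else w) (fun j => by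
      by_cases hj : p j
      · simpa [hj] using (Measure.measurePreserving_swap (μ := μ j) (ν := μ j))
      · simpa [hj] using! MeasurePreserving.id ((μ j).prod (μ j)))
  exact h

omit [MeasurableSpace α] in
lemma mix_swapOn (p q r : Fin n → Prop) [DecidablePred p] [DecidablePred q] [DecidablePred r]
    (h : ∀ j, r j ↔ ¬ (p j ↔ q j)) (z : Fin n → α × α) :
    mix p (swapOn q z) = mix r z := by
  ext j
  have := h j
  by_cases hp : p j <;> by_cases hq : q j <;> simp_all [mix, swapOn]

variable {μ}

lemma integral_comp_swapOn (p : Fin n → Prop) [DecidablePred p]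
    {F : (Fin n → α × α) → ℝ} (hF : AEStronglyMeasurable F (twoCopies μ)) :
    ∫ z, F (swapOn p z) ∂(twoCopies μ) = ∫ z, F z ∂(twoCopies μ) := by
  have h := measurePreserving_swapOn μ p
  conv_rhs => rw [← h.map_eq]
  rw [integral_map h.measurable.aemeasurable (by rwa [h.map_eq])]

lemma integral_comp_mix (p : Fin n → Prop) [DecidablePred p]
    {F : (Fin n → α) → ℝ} (hF : AEStronglyMeasurable F (Measure.pi μ)) :
    ∫ z, F (mix p z) ∂(twoCopies μ) = ∫ x, F x ∂(Measure.pi μ) := by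
  have h := measurePreserving_mix μ p
  conv_rhs => rw [← h.map_eq]
  rw [integral_map h.measurable.aemeasurable (by rwa [h.map_eq])]

lemma integral_mul_mix {f : (Fin n → α) → ℝ} :
    ∫ z, f (mix (fun _ => False) z) * f (mix (fun _ => True) z) ∂(twoCopies μ)
      = (∫ x, f x ∂(Measure.pi μ)) ^ 2 := by
  have h := measurePreserving_arrowProdEquivProdArrow α α (Fin n) μ μ
  rw [sq, ← integral_prod_mul, ← h.integral_comp' ]
  rfl

theorem variance_le {f : (Fin n → α) → ℝ} (hf : MemLp f 2 (Measure.pi μ)) :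
    Var[f; Measure.pi μ] ≤ ∑ i : Fin n,
      ∫ z, (max (f (mix (fun _ => False) z) - f (mix (fun j => j = i) z)) 0) ^ 2
        ∂(twoCopies μ) := by
  classical
  set ν := twoCopies μ with hν
  have hL (p : Fin n → Prop) [DecidablePred p] : MemLp (fun z => f (mix p z)) 2 ν :=
    hf.comp_measurePreserving (measurePreserving_mix μ p)
  let a (k : ℕ) (z : Fin n → α × α) : ℝ := f (mix (fun j : Fin n => (j : ℕ) < k) z)
  let b (z : Fin n → α × α) : ℝ := f (mix (fun _ => False) z)
  let c (i : Fin n) (z : Fin n → α × α) : ℝ := f (mix (fun j => j = i) z)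
  have ha k : MemLp (a k) 2 ν := hL _
  have hb : MemLp b 2 ν := hL _
  have hc i : MemLp (c i) 2 ν := hL _
  have hvar : Var[f; Measure.pi μ] = ∫ z, b z * (a 0 z - a n z) ∂ν := by
    have h1 : ∫ z, b z * a n z ∂ν = (∫ x, f x ∂(Measure.pi μ)) ^ 2 := by
      rw [← integral_mul_mix (μ := μ) (f := f)]
      refine integral_congr_ae (ae_of_all _ fun z => ?_)
      have : mix (fun j : Fin n => (j : ℕ) < n) z = mix (fun _ => True) z := by
        ext j; simp [mix]
      simp only [a, b, this]
    have h2 : ∫ z, b z * a 0 z ∂ν = ∫ x, f x ^ 2 ∂(Measure.pi μ) := by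
      rw [← integral_comp_mix (μ := μ) (fun _ => False) (F := fun x => f x ^ 2)
        (hf.aestronglyMeasurable.pow 2)]
      refine integral_congr_ae (ae_of_all _ fun z => ?_)
      have : mix (fun j : Fin n => (j : ℕ) < 0) z = mix (fun _ => False) z := by
        ext j; simp [mix]
      simp only [a, b, this, sq]
    rw [variance_eq_sub hf, ← h1]
    simp only [mul_sub]
    have i0 : Integrable (fun z => b z * a 0 z) ν := hb.integrable_mul (ha 0)
    have i1 : Integrable (fun z => b z * a n z) ν := hb.integrable_mul (ha n)
    rw [integral_sub i0 i1, h2]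
    rfl
  have htel (z : Fin n → α × α) : b z * (a 0 z - a n z)
      = ∑ i : Fin n, b z * (a i z - a (i + 1) z) := by
    rw [← Finset.mul_sum, Fin.sum_univ_eq_sum_range (fun i => a i z - a (i + 1) z) n,
      Finset.sum_range_sub']
  have hba (i : ℕ) : Integrable (fun z => b z * (a i z - a (i + 1) z)) ν :=
    hb.integrable_mul ((ha i).sub (ha (i + 1)))
  rw [hvar]
  simp_rw [htel]
  rw [integral_finsetSum Finset.univ (f := fun (i : Fin n) z => b z * (a i z - a (i + 1) z))
    fun i _ => hba i]
  refine Finset.sum_le_sum fun i _ => ?_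
  have hswap : ∫ z, b z * (a i z - a (i + 1) z) ∂ν = ∫ z, c i z * (a (i + 1) z - a i z) ∂ν := by
    rw [← integral_comp_swapOn (fun j => j = i)
      (hba i).aestronglyMeasurable]
    refine integral_congr_ae (ae_of_all _ fun z => ?_)
    simp only [a, b, c]
    rw [mix_swapOn (fun _ => False) (fun j => j = i) (fun j => j = i) (by simp),
      mix_swapOn (fun j : Fin n => (j : ℕ) < i) (fun j => j = i)
        (fun j : Fin n => (j : ℕ) < i + 1) (by intro j; simp only [Fin.ext_iff]; grind),
      mix_swapOn (fun j : Fin n => (j : ℕ) < i + 1) (fun j => j = i)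
        (fun j : Fin n => (j : ℕ) < i) (by intro j; simp only [Fin.ext_iff]; grind)]
  have ibc := (hb.sub (hc i)).integrable_sq
  have iaa := ((ha i).sub (ha (i + 1))).integrable_sq
  have hca : Integrable (fun z => c i z * (a (i + 1) z - a i z)) ν :=
    (hc i).integrable_mul ((ha (i + 1)).sub (ha i))
  simp only [Pi.sub_apply] at ibc iaa
  have hsq : ∫ z, (a i z - a (i + 1) z) ^ 2 ∂ν = ∫ z, (b z - c i z) ^ 2 ∂ν := by
    rw [← integral_comp_swapOn (fun j : Fin n => (j : ℕ) < i)
      ibc.aestronglyMeasurable]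
    refine integral_congr_ae (ae_of_all _ fun z => ?_)
    simp only [a, b, c]
    rw [mix_swapOn (fun _ => False) (fun j : Fin n => (j : ℕ) < i)
        (fun j : Fin n => (j : ℕ) < i) (by simp),
      mix_swapOn (fun j => j = i) (fun j : Fin n => (j : ℕ) < i)
        (fun j : Fin n => (j : ℕ) < i + 1) (by intro j; simp only [Fin.ext_iff]; grind)]
  have hbaa : Integrable (fun z => (b z - c i z) * (a i z - a (i + 1) z)) ν :=
    (hb.sub (hc i)).integrable_mul ((ha i).sub (ha (i + 1)))
  have hhalf : ∫ z, b z * (a i z - a (i + 1) z) ∂ν ≤ 1 / 2 * ∫ z, (b z - c i z) ^ 2 ∂ν := by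
    have h1 : 2 * ∫ z, b z * (a i z - a (i + 1) z) ∂ν
        = ∫ z, (b z - c i z) * (a i z - a (i + 1) z) ∂ν := by
      have : ∫ z, (b z - c i z) * (a i z - a (i + 1) z) ∂ν
          = ∫ z, b z * (a i z - a (i + 1) z) ∂ν + ∫ z, c i z * (a (i + 1) z - a i z) ∂ν := by
        rw [← integral_add (hba i) hca]
        refine integral_congr_ae (ae_of_all _ fun z => ?_)
        ring
      rw [this, ← hswap]; ring
    have h2 : ∫ z, (b z - c i z) * (a i z - a (i + 1) z) ∂ν
        ≤ ∫ z, (1 / 2 * (b z - c i z) ^ 2 + 1 / 2 * (a i z - a (i + 1) z) ^ 2) ∂ν := by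
      refine integral_mono hbaa ((ibc.const_mul _).add (iaa.const_mul _)) fun z => ?_
      simp only
      nlinarith [sq_nonneg ((b z - c i z) - (a i z - a (i + 1) z))]
    rw [integral_add (ibc.const_mul _) (iaa.const_mul _), integral_const_mul,
      integral_const_mul, hsq] at h2
    linarith
  have hpos : MemLp (fun z => max (b z - c i z) 0) 2 ν := by
    simpa using (hb.sub (hc i)).pos_part
  have hpos' : MemLp (fun z => max (c i z - b z) 0) 2 ν := by
    simpa using ((hc i).sub hb).pos_part
  have hsym : ∫ z, (max (c i z - b z) 0) ^ 2 ∂ν = ∫ z, (max (b z - c i z) 0) ^ 2 ∂ν := by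
    rw [← integral_comp_swapOn (fun j => j = i) hpos.integrable_sq.aestronglyMeasurable]
    refine integral_congr_ae (ae_of_all _ fun z => ?_)
    simp only [b, c]
    rw [mix_swapOn (fun _ => False) (fun j => j = i) (fun j => j = i) (by simp),
      mix_swapOn (fun j => j = i) (fun j => j = i) (fun _ => False) (by simp)]
  have hsplit : ∫ z, (b z - c i z) ^ 2 ∂ν
      = ∫ z, (max (b z - c i z) 0) ^ 2 ∂ν + ∫ z, (max (c i z - b z) 0) ^ 2 ∂ν := by
    rw [← integral_add hpos.integrable_sq hpos'.integrable_sq]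
    refine integral_congr_ae (ae_of_all _ fun z => ?_)
    rcases le_total (b z) (c i z) with h | h
    · simp only [max_eq_right (sub_nonpos.2 h), max_eq_left (sub_nonneg.2 h)]; ring
    · simp only [max_eq_right (sub_nonpos.2 h), max_eq_left (sub_nonneg.2 h)]; ring
  rw [hsym] at hsplit
  linarith

/-- Variance of the excess of `f` over a level, when the positive increments of `f` under
resampling of one coordinate are controlled by `W`. -/
theorem variance_excess_le {f : (Fin n → α) → ℝ} (hf : MemLp f 2 (Measure.pi μ)) (t : ℝ)
    {W : (Fin n → α × α) → ℝ}
    (hW : ∀ z, ∑ i : Fin n, (max (f (mix (fun _ => False) z) - f (mix (fun j => j = i) z)) 0) ^ 2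
      ≤ W z)
    (hWint : Integrable (fun z => if t < f (mix (fun _ => False) z) then W z else 0)
      (twoCopies μ)) :
    Var[fun x => max (f x - t) 0; Measure.pi μ]
      ≤ ∫ z, (if t < f (mix (fun _ => False) z) then W z else 0) ∂(twoCopies μ) := by
  have hg : MemLp (fun x => max (f x - t) 0) 2 (Measure.pi μ) := by
    simpa using (hf.sub (memLp_const t)).pos_part
  refine (variance_le hg).trans ?_
  have hL (p : Fin n → Prop) [DecidablePred p] :
      MemLp (fun z => max (f (mix p z) - t) 0) 2 (twoCopies μ) :=
    hg.comp_measurePreserving (measurePreserving_mix μ p)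
  have hI (i : Fin n) : Integrable (fun z => (max (max (f (mix (fun _ => False) z) - t) 0
      - max (f (mix (fun j => j = i) z) - t) 0) 0) ^ 2) (twoCopies μ) := by
    have := ((hL (fun _ => False)).sub (hL fun j => j = i)).pos_part.integrable_sq
    simpa using this
  rw [← integral_finsetSum _ fun i _ => hI i]
  refine integral_mono (integrable_finsetSum _ fun i _ => hI i) hWint fun z => ?_
  simp only
  split_ifs with h
  · refine le_trans (Finset.sum_le_sum fun i _ => ?_) (hW z)
    refine pow_le_pow_left₀ (le_max_right _ _) ?_ 2
    refine max_le_max ?_ le_rfl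
    rw [max_eq_left (by linarith)]
    linarith [le_max_left (f (mix (fun j => j = i) z) - t) 0]
  · refine (Finset.sum_eq_zero fun i _ => ?_).le
    rw [max_eq_right (a := f (mix (fun _ => False) z) - t) (by linarith), max_eq_right]
    · simp
    · linarith [le_max_right (f (mix (fun j => j = i) z) - t) 0]

end EfronStein

lemma hasSum_exp_poisson (r : ℝ≥0) :
    HasSum (fun k : ℕ => Real.exp (-r) * r ^ k / (k.factorial : ℝ) * Real.exp k)
      (Real.exp (r * (Real.exp 1 - 1))) := by
  convert! (NormedSpace.expSeries_div_hasSum_exp (r * Real.exp 1 : ℝ)).mul_left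
    (Real.exp (-r)) using 1
  · ext k
    rw [mul_pow, ← Real.exp_nat_mul, mul_one]
    ring
  · rw [← Real.exp_eq_exp_ℝ, ← Real.exp_add]
    ring_nf

lemma integrable_poisson_of_le_exp {r : ℝ≥0} {f : ℕ → ℝ} {K : ℝ}
    (hf : ∀ k, |f k| ≤ K * Real.exp k) : Integrable f (poissonMeasure r) := by
  rw [integrable_poissonMeasure_iff]
  refine Summable.of_nonneg_of_le (fun k => by positivity) (fun k => ?_)
    ((hasSum_exp_poisson r).summable.mul_left K)
  have h := mul_le_mul_of_nonneg_left (hf k)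
    (show 0 ≤ Real.exp (-r) * r ^ k / (k.factorial : ℝ) by positivity)
  rw [Real.norm_eq_abs]
  linarith

lemma integral_poisson_le_of_le_exp {r : ℝ≥0} {f : ℕ → ℝ} {K M : ℝ} (hr : (r : ℝ) ≤ M)
    (hf : ∀ k, |f k| ≤ K * Real.exp k) :
    ∫ k, f k ∂(poissonMeasure r) ≤ K * Real.exp (2 * M) := by
  have hK : 0 ≤ K := by simpa using (abs_nonneg _).trans (hf 0)
  have h1 := hasSum_integral_poissonMeasure (integrable_poisson_of_le_exp (r := r) hf)
  have h2 := (hasSum_exp_poisson r).mul_left K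
  refine (hasSum_le (fun k => ?_) h1 h2).trans ?_
  · have h := mul_le_mul_of_nonneg_left ((le_abs_self _).trans (hf k))
      (show 0 ≤ Real.exp (-r) * r ^ k / (k.factorial : ℝ) by positivity)
    rw [smul_eq_mul]
    linarith
  · have := Real.exp_one_lt_d9
    have := Real.add_one_le_exp (1 : ℝ)
    refine mul_le_mul_of_nonneg_left (Real.exp_le_exp.2 ?_) hK
    nlinarith [r.coe_nonneg]

lemma integral_natCast_poisson (r : ℝ≥0) : ∫ k, (k : ℝ) ∂(poissonMeasure r) = r := by
  have hi : Integrable (fun k : ℕ => (k : ℝ)) (poissonMeasure r) :=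
    integrable_poisson_of_le_exp (K := 1) fun k => by
      rw [abs_of_nonneg (by positivity)]
      linarith [Real.add_one_le_exp (k : ℝ)]
  have h1 := hasSum_integral_poissonMeasure hi
  refine h1.unique ?_
  rw [← hasSum_nat_add_iff' 1]
  have h2 := (hasSum_one_poissonMeasure r).mul_left (r : ℝ)
  simp only [mul_one] at h2
  convert! h2 using 1
  · ext k
    simp only [Nat.factorial_succ, smul_eq_mul]
    push_cast
    field_simp
    ring
  · simp

lemma pow_le_factorial_mul_exp (p k : ℕ) : (k : ℝ) ^ p ≤ p.factorial * Real.exp k := by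
  have := Real.pow_div_factorial_le_exp (k : ℝ) (by positivity) p
  rwa [div_le_iff₀ (by positivity), mul_comm] at this

/-- Moments of a Poisson variable are bounded uniformly over bounded rates. -/
lemma integrable_poisson_of_le_pow {r : ℝ≥0} {f : ℕ → ℝ} {K : ℝ} {p : ℕ} (hK : 0 ≤ K)
    (hf : ∀ k, |f k| ≤ K * (1 + (k : ℝ) ^ p)) : Integrable f (poissonMeasure r) := by
  refine integrable_poisson_of_le_exp (K := K * (1 + p.factorial)) fun k => (hf k).trans ?_
  have := pow_le_factorial_mul_exp p k
  have h1 : 1 ≤ Real.exp k := Real.one_le_exp (by positivity)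
  rw [mul_assoc]
  gcongr
  linarith

lemma integral_poisson_le_of_le_pow {r : ℝ≥0} {f : ℕ → ℝ} {K M : ℝ} {p : ℕ} (hK : 0 ≤ K)
    (hr : (r : ℝ) ≤ M) (hf : ∀ k, |f k| ≤ K * (1 + (k : ℝ) ^ p)) :
    ∫ k, f k ∂(poissonMeasure r) ≤ K * (1 + p.factorial) * Real.exp (2 * M) := by
  refine integral_poisson_le_of_le_exp hr fun k => (hf k).trans ?_
  have := pow_le_factorial_mul_exp p k
  have h1 : 1 ≤ Real.exp k := Real.one_le_exp (by positivity)
  rw [mul_assoc]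
  gcongr
  linarith

lemma memLp_two_poisson_of_le_pow {r : ℝ≥0} {f : ℕ → ℝ} {K : ℝ} {p : ℕ}
    (hf : ∀ k, |f k| ≤ K * (1 + (k : ℝ) ^ p)) : MemLp f 2 (poissonMeasure r) := by
  rw [memLp_two_iff_integrable_sq .of_discrete]
  refine integrable_poisson_of_le_pow (K := 2 * K ^ 2) (p := p * 2) (by positivity) fun k => ?_
  rw [abs_of_nonneg (sq_nonneg _), ← sq_abs]
  calc |f k| ^ 2 ≤ (K * (1 + (k : ℝ) ^ p)) ^ 2 := pow_le_pow_left₀ (abs_nonneg _) (hf k) 2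
    _ ≤ 2 * K ^ 2 * (1 + (k : ℝ) ^ (p * 2)) := by
      rw [pow_mul]
      nlinarith [mul_nonneg (sq_nonneg K) (sq_nonneg (1 - (k : ℝ) ^ p))]

lemma norm_prod_sub_prod_le_sum {ι : Type*} (s : Finset ι) {a b : ι → ℂ}
    (ha : ∀ i ∈ s, ‖a i‖ ≤ 1) (hb : ∀ i ∈ s, ‖b i‖ ≤ 1) :
    ‖∏ i ∈ s, a i - ∏ i ∈ s, b i‖ ≤ ∑ i ∈ s, ‖a i - b i‖ := by
  classical
  induction s using Finset.induction_on with
  | empty => simp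
  | insert j s hj ih =>
    rw [Finset.prod_insert hj, Finset.prod_insert hj, Finset.sum_insert hj]
    have h1 := ih (fun i hi => ha i (Finset.mem_insert_of_mem hi))
      (fun i hi => hb i (Finset.mem_insert_of_mem hi))
    have h2 : ‖∏ i ∈ s, a i‖ ≤ 1 := by
      rw [norm_prod]
      exact Finset.prod_le_one (fun _ _ => norm_nonneg _)
        fun i hi => ha i (Finset.mem_insert_of_mem hi)
    calc ‖a j * ∏ i ∈ s, a i - b j * ∏ i ∈ s, b i‖
        = ‖(a j - b j) * ∏ i ∈ s, a i + b j * (∏ i ∈ s, a i - ∏ i ∈ s, b i)‖ := by ring_nf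
      _ ≤ ‖a j - b j‖ * ‖∏ i ∈ s, a i‖ + ‖b j‖ * ‖∏ i ∈ s, a i - ∏ i ∈ s, b i‖ := by
          simpa only [norm_mul] using norm_add_le ((a j - b j) * ∏ i ∈ s, a i)
            (b j * (∏ i ∈ s, a i - ∏ i ∈ s, b i))
      _ ≤ ‖a j - b j‖ * 1 + 1 * ∑ i ∈ s, ‖a i - b i‖ := by
          gcongr
          exact hb j (Finset.mem_insert_self _ _)
      _ = _ := by ring

lemma norm_cexp_sub_quadratic_le (x : ℝ) :
    ‖Complex.exp (x * Complex.I) - (1 + x * Complex.I - (x : ℂ) ^ 2 / 2)‖ ≤ 4 * |x| ^ 3 := by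
  have hn : ‖(x : ℂ) * Complex.I‖ = |x| := by simp
  rcases le_or_gt |x| 1 with h | h
  · have := Complex.exp_bound (x := x * Complex.I) (by rw [hn]; exact h) (n := 3) (by norm_num)
    rw [hn] at this
    have e : (∑ m ∈ Finset.range 3, ((x : ℂ) * Complex.I) ^ m / (m.factorial : ℂ))
        = 1 + x * Complex.I - (x : ℂ) ^ 2 / 2 := by
      simp [Finset.sum_range_succ, mul_pow, Nat.factorial]
      ring
    rw [e] at this
    refine this.trans ?_
    rw [mul_comm]
    gcongr
    norm_num [Nat.factorial]
  · have h1 : ‖Complex.exp (x * Complex.I)‖ = 1 := Complex.norm_exp_ofReal_mul_I x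
    have h2 : ‖(x : ℂ) ^ 2 / 2‖ = |x| ^ 2 / 2 := by simp
    have h3 : |x| ≤ |x| ^ 3 := le_self_pow₀ h.le (by norm_num)
    have h4 : |x| ^ 2 ≤ |x| ^ 3 := pow_le_pow_right₀ h.le (by norm_num)
    calc _ ≤ ‖Complex.exp (x * Complex.I)‖ + (‖(1 : ℂ)‖ + ‖x * Complex.I‖ + ‖(x : ℂ) ^ 2 / 2‖) :=
          (norm_sub_le _ _).trans (add_le_add le_rfl ((norm_sub_le _ _).trans
            (add_le_add (norm_add_le _ _) le_rfl)))
      _ ≤ _ := by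
          rw [h1, hn, h2, norm_one]
          linarith

lemma abs_exp_neg_sub_le {w : ℝ} (hw : 0 ≤ w) : |Real.exp (-w) - (1 - w)| ≤ w ^ 2 := by
  have h1 := Real.add_one_le_exp (-w)
  have h2 : Real.exp (-w) ≤ (1 + w)⁻¹ := by
    rw [Real.exp_neg]
    exact inv_anti₀ (by linarith) (by linarith [Real.add_one_le_exp w])
  have h3 : (1 + w)⁻¹ ≤ 1 - w + w ^ 2 := by
    rw [inv_le_iff_one_le_mul₀ (by linarith)]
    nlinarith [pow_nonneg hw 3]
  rw [abs_le]
  constructor <;> nlinarith [sq_nonneg w]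

lemma norm_charFun_sub_exp_le {Ω : Type*} [MeasurableSpace Ω] {μ : Measure Ω}
    [IsProbabilityMeasure μ] {Y : Ω → ℝ} (hY : MemLp Y 2 μ) (h0 : ∫ ω, Y ω ∂μ = 0)
    (h3 : Integrable (fun ω => |Y ω| ^ 3) μ) (u : ℝ) :
    ‖∫ ω, Complex.exp ((u * Y ω : ℝ) * Complex.I) ∂μ
        - Complex.exp (-(u ^ 2 * (∫ ω, Y ω ^ 2 ∂μ) / 2 : ℝ))‖
      ≤ 4 * |u| ^ 3 * ∫ ω, |Y ω| ^ 3 ∂μ + u ^ 4 * (1 + ∫ ω, |Y ω| ^ 3 ∂μ) ^ 2 := by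
  set v := ∫ ω, Y ω ^ 2 ∂μ with hv
  set K := ∫ ω, |Y ω| ^ 3 ∂μ with hK
  have hv0 : 0 ≤ v := integral_nonneg fun _ => sq_nonneg _
  have hvK : v ≤ 1 + K := by
    calc v ≤ ∫ ω, (1 + |Y ω| ^ 3) ∂μ := by
          refine integral_mono hY.integrable_sq ((integrable_const 1).add h3) fun ω => ?_
          simp only
          rw [← sq_abs]
          rcases le_total |Y ω| 1 with h | h
          · nlinarith [abs_nonneg (Y ω), pow_nonneg (abs_nonneg (Y ω)) 3]
          · linarith [pow_le_pow_right₀ h (show 2 ≤ 3 by norm_num)]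
      _ = 1 + K := by rw [integral_add (integrable_const 1) h3]; simp [hK]
  have hm : AEStronglyMeasurable Y μ := hY.aestronglyMeasurable
  have hYi : Integrable Y μ := hY.integrable (by norm_num)
  have hcE : Integrable (fun ω => Complex.exp ((u * Y ω : ℝ) * Complex.I)) μ := by
    refine Integrable.of_bound (C := 1) ?_ (ae_of_all _ fun ω => ?_)
    · have : Continuous fun y : ℝ => Complex.exp ((u * y : ℝ) * Complex.I) := by fun_prop
      exact this.comp_aestronglyMeasurable hm
    · exact (Complex.norm_exp_ofReal_mul_I _).le
  have hq1 : Integrable (fun ω => ((u * Y ω : ℝ) : ℂ) * Complex.I) μ :=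
    ((hYi.const_mul u).ofReal).mul_const _
  have hq2 : Integrable (fun ω => ((u * Y ω : ℝ) : ℂ) ^ 2 / 2) μ := by
    have := ((hY.integrable_sq.const_mul (u ^ 2)).ofReal (𝕜 := ℂ)).div_const 2
    refine this.congr (ae_of_all _ fun ω => ?_)
    simp [mul_pow]
  have hint : ∫ ω, (1 + ((u * Y ω : ℝ) : ℂ) * Complex.I - ((u * Y ω : ℝ) : ℂ) ^ 2 / 2) ∂μ
      = ((1 - u ^ 2 * v / 2 : ℝ) : ℂ) := by
    have e1 : ∫ ω, ((u * Y ω : ℝ) : ℂ) * Complex.I ∂μ = 0 := by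
      rw [integral_mul_const, integral_complex_ofReal, integral_const_mul, h0]; simp
    have e2 : ∫ ω, ((u * Y ω : ℝ) : ℂ) ^ 2 / 2 ∂μ = ((u ^ 2 * v / 2 : ℝ) : ℂ) := by
      rw [hv, ← integral_const_mul, ← integral_div, ← integral_complex_ofReal]
      refine integral_congr_ae (ae_of_all _ fun ω => ?_)
      simp [mul_pow]
    have i1 : Integrable (fun ω => (1 : ℂ) + ((u * Y ω : ℝ) : ℂ) * Complex.I) μ :=
      (integrable_const 1).add hq1
    rw [integral_sub i1 hq2, integral_add (integrable_const 1) hq1, e1, e2]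
    simp
  have hA : ‖∫ ω, Complex.exp ((u * Y ω : ℝ) * Complex.I) ∂μ - ((1 - u ^ 2 * v / 2 : ℝ) : ℂ)‖
      ≤ 4 * |u| ^ 3 * K := by
    have i2 : Integrable (fun ω => (1 : ℂ) + ((u * Y ω : ℝ) : ℂ) * Complex.I
        - ((u * Y ω : ℝ) : ℂ) ^ 2 / 2) μ := ((integrable_const 1).add hq1).sub hq2
    rw [← hint, ← integral_sub hcE i2, hK, ← integral_const_mul]
    refine norm_integral_le_of_norm_le (h3.const_mul _) (ae_of_all _ fun ω => ?_)
    refine (norm_cexp_sub_quadratic_le (u * Y ω)).trans_eq ?_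
    rw [abs_mul]; ring
  have hB : ‖((1 - u ^ 2 * v / 2 : ℝ) : ℂ) - Complex.exp (-(u ^ 2 * v / 2 : ℝ))‖
      ≤ u ^ 4 * (1 + K) ^ 2 := by
    rw [← Complex.ofReal_neg, ← Complex.ofReal_exp, ← Complex.ofReal_sub, Complex.norm_real,
      Real.norm_eq_abs, abs_sub_comm]
    refine (abs_exp_neg_sub_le (by positivity)).trans ?_
    calc (u ^ 2 * v / 2) ^ 2 = u ^ 4 * v ^ 2 / 4 := by ring
      _ ≤ u ^ 4 * v ^ 2 := by
          have : 0 ≤ u ^ 4 * v ^ 2 := by positivity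
          linarith
      _ ≤ u ^ 4 * (1 + K) ^ 2 := by gcongr
  exact (norm_sub_le_norm_sub_add_norm_sub _ _ _).trans (add_le_add hA hB)

namespace PoissonBins

/-- Lyapunov's central limit theorem for the rows of a triangular array of independent variables
with variances bounded below and third absolute central moments bounded above. -/
theorem tendstoInDistribution_standardize_sum {Ω : Type*} [MeasurableSpace Ω]
    (μ : (n : ℕ) → Fin n → Measure Ω) [∀ n i, IsProbabilityMeasure (μ n i)]
    (ξ : (n : ℕ) → Fin n → Ω → ℝ) (hξ : ∀ n i, MemLp (ξ n i) 2 (μ n i)) {c K : ℝ} (hc : 0 < c)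
    (hvar : ∀ n i, c ≤ Var[ξ n i; μ n i])
    (h3 : ∀ n i, Integrable (fun ω => |ξ n i ω - ∫ ω', ξ n i ω' ∂(μ n i)| ^ 3) (μ n i))
    (hK : ∀ n i, ∫ ω, |ξ n i ω - ∫ ω', ξ n i ω' ∂(μ n i)| ^ 3 ∂(μ n i) ≤ K) :
    TendstoInDistribution
      (fun (n : ℕ) => standardize (fun x : Fin n → Ω => ∑ i, ξ n i (x i)) (Measure.pi (μ n)))
      atTop (id : ℝ → ℝ) (fun n => Measure.pi (μ n)) (gaussianReal 0 1) := by
  have hL (n : ℕ) (i : Fin n) : MemLp (fun x : Fin n → Ω => ξ n i (x i)) 2 (Measure.pi (μ n)) :=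
    (hξ n i).comp_measurePreserving (measurePreserving_eval _ i)
  have hS (n : ℕ) : MemLp (fun x : Fin n → Ω => ∑ i, ξ n i (x i)) 2 (Measure.pi (μ n)) :=
    memLp_finsetSum _ fun i _ => hL n i
  have hmean (n : ℕ) : ∫ x, ∑ i, ξ n i (x i) ∂(Measure.pi (μ n))
      = ∑ i, ∫ ω, ξ n i ω ∂(μ n i) := by
    rw [integral_finsetSum _ fun i _ => (hL n i).integrable (by norm_num)]
    exact Finset.sum_congr rfl fun i _ => integral_comp_eval (hξ n i).aestronglyMeasurable
  have hV (n : ℕ) : Var[fun x : Fin n → Ω => ∑ i, ξ n i (x i); Measure.pi (μ n)]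
      = ∑ i, Var[ξ n i; μ n i] := by
    rw [← variance_sum_pi (hξ n)]
    congr 1
    ext x
    simp
  have hmeas (n : ℕ) : AEMeasurable
      (standardize (fun x : Fin n → Ω => ∑ i, ξ n i (x i)) (Measure.pi (μ n)))
      (Measure.pi (μ n)) :=
    ((hS n).aestronglyMeasurable.aemeasurable.sub_const _).div_const _
  refine ⟨hmeas, aemeasurable_id, ProbabilityMeasure.tendsto_of_tendsto_charFun fun t => ?_⟩
  simp only [ProbabilityMeasure.coe_mk, Measure.map_id]
  rw [charFun_gaussianReal]
  set σ : ℕ → ℝ := fun n => Real.sqrt (∑ i, Var[ξ n i; μ n i]) with hσ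
  let Y (n : ℕ) (i : Fin n) (ω : Ω) : ℝ := ξ n i ω - ∫ ω', ξ n i ω' ∂(μ n i)
  have hY n i : MemLp (Y n i) 2 (μ n i) := (hξ n i).sub (memLp_const _)
  have hY0 n i : ∫ ω, Y n i ω ∂(μ n i) = 0 := by
    simp only [Y]
    rw [integral_sub ((hξ n i).integrable (by norm_num)) (integrable_const _)]
    simp
  have hYv n i : ∫ ω, Y n i ω ^ 2 ∂(μ n i) = Var[ξ n i; μ n i] :=
    (variance_eq_integral (hξ n i).aestronglyMeasurable.aemeasurable).symm
  have hchar (n : ℕ) : charFun ((Measure.pi (μ n)).map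
      (standardize (fun x : Fin n → Ω => ∑ i, ξ n i (x i)) (Measure.pi (μ n)))) t
      = ∏ i, ∫ ω, Complex.exp ((t / σ n * Y n i ω : ℝ) * Complex.I) ∂(μ n i) := by
    rw [charFun_apply_real, integral_map (hmeas n) (by fun_prop),
      ← integral_fintype_prod_eq_prod]
    refine integral_congr_ae (ae_of_all _ fun x => ?_)
    simp only [standardize]
    rw [hmean, hV, ← Finset.sum_sub_distrib, ← Complex.exp_sum, ← Finset.sum_mul,
      ← Complex.ofReal_sum, ← Finset.mul_sum, ← Complex.ofReal_mul]
    simp only [Y, hσ]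
    congr 3
    ring
  have hsum (n : ℕ) : (n : ℝ) * c ≤ ∑ i, Var[ξ n i; μ n i] := by
    simpa using Finset.card_nsmul_le_sum Finset.univ (fun i => Var[ξ n i; μ n i]) c
      fun i _ => hvar n i
  have hσtop : Tendsto σ atTop atTop := by
    refine Real.tendsto_sqrt_atTop.comp (tendsto_atTop_mono hsum ?_)
    exact tendsto_natCast_atTop_atTop.atTop_mul_const hc
  have hbound : ∀ᶠ n in atTop,
      ‖charFun ((Measure.pi (μ n)).map
        (standardize (fun x : Fin n → Ω => ∑ i, ξ n i (x i)) (Measure.pi (μ n)))) t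
        - Complex.exp (-(t ^ 2 / 2 : ℝ))‖
      ≤ 1 / c * (4 * |t| ^ 3 * K * (σ n)⁻¹ + t ^ 4 * (1 + K) ^ 2 * ((σ n)⁻¹) ^ 2) := by
    filter_upwards [hσtop.eventually_gt_atTop 0] with n hn
    have hσ2 : σ n ^ 2 = ∑ i, Var[ξ n i; μ n i] :=
      Real.sq_sqrt (Finset.sum_nonneg fun i _ => variance_nonneg _ _)
    have hexp : Complex.exp (-(t ^ 2 / 2 : ℝ))
        = ∏ i, Complex.exp (-((t / σ n) ^ 2 * (∫ ω, Y n i ω ^ 2 ∂(μ n i)) / 2 : ℝ)) := by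
      rw [← Complex.exp_sum, Finset.sum_neg_distrib, ← Complex.ofReal_sum, ← Finset.sum_div,
        ← Finset.mul_sum]
      simp_rw [hYv]
      rw [← hσ2]
      congr 3
      field_simp
    rw [hchar, hexp]
    refine (norm_prod_sub_prod_le_sum _ (fun i _ => ?_) (fun i _ => ?_)).trans ?_
    · refine (norm_integral_le_of_norm_le (integrable_const (1 : ℝ))
        (ae_of_all _ fun ω => (Complex.norm_exp_ofReal_mul_I _).le)).trans_eq ?_
      simp
    · rw [← Complex.ofReal_neg, ← Complex.ofReal_exp, Complex.norm_real, Real.norm_eq_abs,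
        Real.abs_exp, Real.exp_le_one_iff]
      have : 0 ≤ ∫ ω, Y n i ω ^ 2 ∂(μ n i) := integral_nonneg fun _ => sq_nonneg _
      rw [neg_nonpos]
      positivity
    · have hterm (i : Fin n) := norm_charFun_sub_exp_le (hY n i) (hY0 n i) (h3 n i) (t / σ n)
      have hKi (i : Fin n) : ∫ ω, |Y n i ω| ^ 3 ∂(μ n i) ≤ K := hK n i
      have hK0 (i : Fin n) : 0 ≤ ∫ ω, |Y n i ω| ^ 3 ∂(μ n i) :=
        integral_nonneg fun _ => by positivity
      calc _ ≤ ∑ i : Fin n, (4 * |t / σ n| ^ 3 * K + (t / σ n) ^ 4 * (1 + K) ^ 2) := by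
            refine Finset.sum_le_sum fun i _ => (hterm i).trans ?_
            have := hKi i
            have := hK0 i
            gcongr
        _ = n * (4 * |t / σ n| ^ 3 * K + (t / σ n) ^ 4 * (1 + K) ^ 2) := by simp; ring
        _ ≤ (σ n ^ 2 / c) * (4 * |t / σ n| ^ 3 * K + (t / σ n) ^ 4 * (1 + K) ^ 2) := by
            rcases Nat.eq_zero_or_pos n with rfl | hpos
            · simp [hσ] at hn
            have hK' : 0 ≤ K := (hK0 ⟨0, hpos⟩).trans (hKi ⟨0, hpos⟩)
            gcongr
            rw [le_div_iff₀ hc, hσ2]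
            exact hsum n
        _ = _ := by
            rw [abs_div, abs_of_pos hn]
            field_simp
  have hlim : Tendsto (fun n => 1 / c * (4 * |t| ^ 3 * K * (σ n)⁻¹
      + t ^ 4 * (1 + K) ^ 2 * ((σ n)⁻¹) ^ 2)) atTop (𝓝 0) := by
    have h := tendsto_inv_atTop_zero.comp hσtop
    have := ((h.const_mul (4 * |t| ^ 3 * K)).add
      ((h.pow 2).const_mul (t ^ 4 * (1 + K) ^ 2))).const_mul (1 / c)
    simpa using this
  rw [tendsto_iff_norm_sub_tendsto_zero]
  refine squeeze_zero' (Eventually.of_forall fun n => norm_nonneg _) ?_ hlim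
  filter_upwards [hbound] with n hn
  convert! hn using 4
  simp

end PoissonBins

section CauchySchwarz
variable {Ω : Type*} [MeasurableSpace Ω] {μ : Measure Ω} {f g : Ω → ℝ}

lemma sq_integral_mul_le (hf : MemLp f 2 μ) (hg : MemLp g 2 μ) :
    (∫ ω, f ω * g ω ∂μ) ^ 2 ≤ (∫ ω, f ω ^ 2 ∂μ) * ∫ ω, g ω ^ 2 ∂μ := by
  have hfg : Integrable (fun ω => f ω * g ω) μ := hf.integrable_mul hg
  have h (x : ℝ) : 0 ≤ (∫ ω, f ω ^ 2 ∂μ) * (x * x) + (2 * ∫ ω, f ω * g ω ∂μ) * x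
      + ∫ ω, g ω ^ 2 ∂μ := by
    have : ∫ ω, (x * f ω + g ω) ^ 2 ∂μ = (∫ ω, f ω ^ 2 ∂μ) * (x * x)
        + (2 * ∫ ω, f ω * g ω ∂μ) * x + ∫ ω, g ω ^ 2 ∂μ := by
      have e : (fun ω => (x * f ω + g ω) ^ 2)
          = fun ω => (f ω ^ 2 * (x * x) + (f ω * g ω) * (2 * x)) + g ω ^ 2 := by
        ext ω; ring
      have i1 := hf.integrable_sq.mul_const (x * x)
      have i2 := hfg.mul_const (2 * x)
      have i12 : Integrable (fun ω => f ω ^ 2 * (x * x) + (f ω * g ω) * (2 * x)) μ := i1.add i2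
      rw [e, integral_add i12 hg.integrable_sq, integral_add i1 i2, integral_mul_const,
        integral_mul_const]
      ring
    rw [← this]
    exact integral_nonneg fun _ => sq_nonneg _
  have := discrim_le_zero h
  rw [discrim] at this
  nlinarith

lemma integral_mul_le_sqrt (hf : MemLp f 2 μ) (hg : MemLp g 2 μ) :
    ∫ ω, f ω * g ω ∂μ ≤ Real.sqrt (∫ ω, f ω ^ 2 ∂μ) * Real.sqrt (∫ ω, g ω ^ 2 ∂μ) := by
  rw [← Real.sqrt_mul (integral_nonneg fun _ => sq_nonneg _)]
  exact Real.le_sqrt_of_sq_le (sq_integral_mul_le hf hg)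

lemma integral_abs_le_sqrt [IsProbabilityMeasure μ] (hf : MemLp f 2 μ) :
    ∫ ω, |f ω| ∂μ ≤ Real.sqrt (∫ ω, f ω ^ 2 ∂μ) := by
  have := integral_mul_le_sqrt hf.abs (memLp_const (1 : ℝ))
  simpa using this

lemma abs_sqrt_variance_sub_le [IsProbabilityMeasure μ] (hf : MemLp f 2 μ) (hg : MemLp g 2 μ) :
    |Real.sqrt Var[f; μ] - Real.sqrt Var[g; μ]| ≤ Real.sqrt Var[fun ω => f ω - g ω; μ] := by
  have hc : cov[f, g; μ] ≤ Real.sqrt Var[f; μ] * Real.sqrt Var[g; μ] := by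
    rw [variance_eq_integral hf.aestronglyMeasurable.aemeasurable,
      variance_eq_integral hg.aestronglyMeasurable.aemeasurable]
    exact integral_mul_le_sqrt (hf.sub (memLp_const _)) (hg.sub (memLp_const _))
  refine Real.abs_le_sqrt ?_
  rw [variance_fun_sub hf hg, sub_sq, Real.sq_sqrt (variance_nonneg _ _),
    Real.sq_sqrt (variance_nonneg _ _)]
  linarith

end CauchySchwarz

namespace PoissonBins

section Transfer

lemma memLp_standardize {Ω : Type*} [MeasurableSpace Ω] {μ : Measure Ω} [IsProbabilityMeasure μ]
    {X : Ω → ℝ} (hX : MemLp X 2 μ) : MemLp (standardize X μ) 2 μ := by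
  have h : MemLp (fun ω => (X ω - ∫ ω', X ω' ∂μ) * (Real.sqrt Var[X; μ])⁻¹) 2 μ :=
    (hX.sub (memLp_const _)).mul_const _
  exact h

lemma integral_abs_standardize_sub_le {Ω : Type*} [MeasurableSpace Ω] {μ : Measure Ω}
    [IsProbabilityMeasure μ] {X Y : Ω → ℝ} (hX : MemLp X 2 μ) (hY : MemLp Y 2 μ)
    (hpos : 0 < Var[X; μ]) :
    ∫ ω, |standardize Y μ ω - standardize X μ ω| ∂μ
      ≤ 2 * Real.sqrt ((∫ ω, (X ω - Y ω) ^ 2 ∂μ) / Var[X; μ]) := by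
  set σ := Real.sqrt Var[X; μ] with hσ
  set τ := Real.sqrt Var[Y; μ] with hτ
  set δ := Real.sqrt Var[fun ω => X ω - Y ω; μ] with hδ
  have hσ0 : 0 < σ := Real.sqrt_pos.2 hpos
  have hτ0 : 0 ≤ τ := Real.sqrt_nonneg _
  let U (ω : Ω) : ℝ := X ω - ∫ ω', X ω' ∂μ
  let W (ω : Ω) : ℝ := Y ω - ∫ ω', Y ω' ∂μ
  have hU : MemLp U 2 μ := hX.sub (memLp_const _)
  have hW : MemLp W 2 μ := hY.sub (memLp_const _)
  have hUi := hU.integrable (q := 2) (by norm_num)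
  have hWi := hW.integrable (q := 2) (by norm_num)
  have hWτ : ∫ ω, |W ω| ∂μ ≤ τ := by
    rw [hτ, variance_eq_integral hY.aestronglyMeasurable.aemeasurable]
    exact integral_abs_le_sqrt hW
  have hUWδ : ∫ ω, |U ω - W ω| ∂μ ≤ δ := by
    have hXY : MemLp (fun ω => X ω - Y ω) 2 μ := hX.sub hY
    rw [hδ, variance_eq_integral hXY.aestronglyMeasurable.aemeasurable]
    refine (integral_abs_le_sqrt (hU.sub hW)).trans_eq ?_
    congr 1
    refine integral_congr_ae (ae_of_all _ fun ω => ?_)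
    simp only [Pi.sub_apply, U, W]
    rw [integral_sub (hX.integrable (by norm_num)) (hY.integrable (by norm_num))]
    ring
  have hστ : |σ - τ| ≤ δ := abs_sqrt_variance_sub_le hX hY
  have hpt (ω : Ω) : |standardize Y μ ω - standardize X μ ω|
      ≤ |U ω - W ω| * σ⁻¹ + |W ω| * |τ⁻¹ - σ⁻¹| := by
    have : standardize Y μ ω - standardize X μ ω
        = -((U ω - W ω) * σ⁻¹) + W ω * (τ⁻¹ - σ⁻¹) := by
      simp only [standardize, U, W, div_eq_mul_inv, ← hσ, ← hτ]; ring
    rw [this]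
    refine (abs_add_le _ _).trans_eq ?_
    rw [abs_neg, abs_mul, abs_mul, abs_of_pos (inv_pos.2 hσ0)]
  have hI : ∫ ω, |standardize Y μ ω - standardize X μ ω| ∂μ ≤ δ * σ⁻¹ + τ * |τ⁻¹ - σ⁻¹| := by
    have i1 := ((hUi.sub hWi).abs).mul_const σ⁻¹
    have i2 := hWi.abs.mul_const |τ⁻¹ - σ⁻¹|
    calc _ ≤ ∫ ω, (|U ω - W ω| * σ⁻¹ + |W ω| * |τ⁻¹ - σ⁻¹|) ∂μ :=
          integral_mono (((memLp_standardize hY).sub (memLp_standardize hX)).integrable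
            (by norm_num)).abs (i1.add i2) hpt
      _ = (∫ ω, |U ω - W ω| ∂μ) * σ⁻¹ + (∫ ω, |W ω| ∂μ) * |τ⁻¹ - σ⁻¹| := by
          rw [← integral_mul_const, ← integral_mul_const]
          exact integral_add i1 i2
      _ ≤ _ := by gcongr
  have h2 : τ * |τ⁻¹ - σ⁻¹| ≤ δ * σ⁻¹ := by
    rcases hτ0.eq_or_lt with h | h
    · rw [← h, zero_mul]
      have : 0 ≤ δ := Real.sqrt_nonneg _
      positivity
    · have : τ * |τ⁻¹ - σ⁻¹| = |σ - τ| * σ⁻¹ := by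
        rw [← abs_of_pos h, ← abs_mul, abs_of_pos h, ← abs_of_pos (inv_pos.2 hσ0), ← abs_mul,
          abs_of_pos (inv_pos.2 hσ0)]
        congr 1
        field_simp
      rw [this]
      gcongr
  have h3 : δ * σ⁻¹ ≤ Real.sqrt ((∫ ω, (X ω - Y ω) ^ 2 ∂μ) / Var[X; μ]) := by
    rw [Real.sqrt_div' _ hpos.le, ← div_eq_mul_inv]
    refine div_le_div_of_nonneg_right (Real.sqrt_le_sqrt ?_) hσ0.le
    exact variance_le_expectation_sq (hX.sub hY).aestronglyMeasurable
  linarith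

/-- Standardization is asymptotically insensitive to perturbations which are negligible in `L²`
compared to the standard deviation. -/
theorem tendstoInDistribution_standardize_of_sub {Ω : ℕ → Type*} [∀ n, MeasurableSpace (Ω n)]
    {μ : (n : ℕ) → Measure (Ω n)} [∀ n, IsProbabilityMeasure (μ n)]
    {Ω' : Type*} [MeasurableSpace Ω'] {P : Measure Ω'} [IsProbabilityMeasure P] {Z : Ω' → ℝ}
    {X Y : (n : ℕ) → Ω n → ℝ} (hX : ∀ n, MemLp (X n) 2 (μ n)) (hY : ∀ n, MemLp (Y n) 2 (μ n))
    (hpos : ∀ᶠ n in atTop, 0 < Var[X n; μ n])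
    (hsub : Tendsto (fun n => (∫ ω, (X n ω - Y n ω) ^ 2 ∂(μ n)) / Var[X n; μ n]) atTop (𝓝 0))
    (hlim : TendstoInDistribution (fun n => standardize (X n) (μ n)) atTop Z μ P) :
    TendstoInDistribution (fun n => standardize (Y n) (μ n)) atTop Z μ P := by
  have hmY n := (memLp_standardize (hY n)).aestronglyMeasurable.aemeasurable
  refine ⟨hmY, hlim.aemeasurable_limit, ?_⟩
  have hl := hlim.tendsto
  refine (tendsto_iff_forall_lipschitz_integral_tendsto (Ω := ℝ)).2 ?_
  replace hl := (tendsto_iff_forall_lipschitz_integral_tendsto (Ω := ℝ)).1 hl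
  intro F hFb hFL
  specialize hl F hFb hFL
  obtain ⟨L, hL⟩ := hFL
  obtain ⟨C, hC⟩ := hFb
  have hFc : Continuous F := hL.continuous
  have hFint (n : ℕ) {V : Ω n → ℝ} (hV : AEMeasurable V (μ n)) :
      Integrable (fun ω => F (V ω)) (μ n) := by
    refine Integrable.of_bound (hFc.measurable.comp_aemeasurable hV).aestronglyMeasurable
      (C + ‖F 0‖) (ae_of_all _ fun ω => ?_)
    have h1 := hC (V ω) 0
    rw [dist_eq_norm] at h1
    have h2 := norm_le_norm_sub_add (F (V ω)) (F 0)
    linarith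
  have hdiff : Tendsto (fun n => (∫ ω, F ω ∂((μ n).map (standardize (Y n) (μ n))))
      - ∫ ω, F ω ∂((μ n).map (standardize (X n) (μ n)))) atTop (𝓝 0) := by
    have hs : Tendsto (fun n => (L : ℝ) * (2 * Real.sqrt ((∫ ω, (X n ω - Y n ω) ^ 2 ∂(μ n))
        / Var[X n; μ n]))) atTop (𝓝 0) := by
      simpa using (hsub.sqrt.const_mul 2).const_mul (L : ℝ)
    refine squeeze_zero_norm' ?_ hs
    filter_upwards [hpos] with n hn
    have hmX := (memLp_standardize (hX n)).aestronglyMeasurable.aemeasurable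
    rw [integral_map (hmY n) hFc.aestronglyMeasurable, integral_map hmX hFc.aestronglyMeasurable,
      ← integral_sub (hFint n (hmY n)) (hFint n hmX)]
    have hi : Integrable (fun ω => (L : ℝ) *
        |standardize (Y n) (μ n) ω - standardize (X n) (μ n) ω|) (μ n) :=
      ((((memLp_standardize (hY n)).sub (memLp_standardize (hX n))).integrable
        (by norm_num)).abs).const_mul _
    refine (norm_integral_le_of_norm_le hi (ae_of_all _ fun ω => ?_)).trans ?_
    · have := hL.dist_le_mul (standardize (Y n) (μ n) ω) (standardize (X n) (μ n) ω)
      rwa [dist_eq_norm, Real.dist_eq] at this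
    · rw [integral_const_mul]
      gcongr
      exact integral_abs_standardize_sub_le (hX n) (hY n) hn
  simpa using! hdiff.add hl

end Transfer
end PoissonBins

/-- The variance of a function of a Poisson variable, bounded below by its second difference
at the origin. -/
lemma le_variance_poisson {r : ℝ≥0} {ε M : ℝ} (hε : 0 < ε) (hr : ε ≤ r) (hM : (r : ℝ) ≤ M)
    {f : ℕ → ℝ} (hf : MemLp f 2 (poissonMeasure r)) :
    Real.exp (-M) * min 1 (min ε (ε ^ 2 / 2)) * ((f 0 - 2 * f 1 + f 2) ^ 2 / 6)
      ≤ Var[f; poissonMeasure r] := by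
  rw [variance_eq_integral hf.aestronglyMeasurable.aemeasurable]
  set m := ∫ k, f k ∂(poissonMeasure r)
  set q := min 1 (min ε (ε ^ 2 / 2)) with hq
  have hi : Integrable (fun k => (f k - m) ^ 2) (poissonMeasure r) :=
    (hf.sub (memLp_const m)).integrable_sq
  have h1 := sum_le_hasSum (Finset.range 3) (fun k _ => by
    show 0 ≤ (Real.exp (-r) * r ^ k / (k.factorial : ℝ)) • (f k - m) ^ 2
    rw [smul_eq_mul]; positivity) (hasSum_integral_poissonMeasure hi)
  refine le_trans ?_ h1
  have hq0 : 0 < q := by positivity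
  have hE : Real.exp (-M) ≤ Real.exp (-r) := Real.exp_le_exp.2 (by linarith)
  have e0 : Real.exp (-M) * q ≤ Real.exp (-r) * 1 := by
    gcongr; exact min_le_left _ _
  have e1 : Real.exp (-M) * q ≤ Real.exp (-r) * r := by
    gcongr; exact ((min_le_right _ _).trans (min_le_left _ _)).trans hr
  have e2 : Real.exp (-M) * q ≤ Real.exp (-r) * r ^ 2 / 2 := by
    rw [mul_div_assoc]
    gcongr
    refine ((min_le_right _ _).trans (min_le_right _ _)).trans ?_
    gcongr
  have k0 := mul_le_mul_of_nonneg_right e0 (sq_nonneg (f 0 - m))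
  have k1 := mul_le_mul_of_nonneg_right e1 (sq_nonneg (f 1 - m))
  have k2 := mul_le_mul_of_nonneg_right e2 (sq_nonneg (f 2 - m))
  have hcs : (f 0 - 2 * f 1 + f 2) ^ 2 / 6
      ≤ (f 0 - m) ^ 2 + (f 1 - m) ^ 2 + (f 2 - m) ^ 2 := by
    nlinarith [sq_nonneg (2 * (f 0 - m) + (f 1 - m)), sq_nonneg ((f 0 - m) - (f 2 - m)),
      sq_nonneg (2 * (f 2 - m) + (f 1 - m))]
  have := mul_le_mul_of_nonneg_left hcs (show 0 ≤ Real.exp (-M) * q by positivity)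
  simp only [Finset.sum_range_succ, Finset.sum_range_zero, smul_eq_mul, Nat.factorial]
  norm_num
  norm_num at k0 k1 k2
  linarith

namespace PoissonBins

/-- Half the contribution of a bin with rate `r` and count `k` to the `C` function. -/
def binDeviance (r : ℝ) (k : ℕ) : ℝ := r - k * Real.log r - k + k * Real.log k

lemma binDeviance_nonneg {r : ℝ} (hr : 0 < r) (k : ℕ) : 0 ≤ binDeviance r k := by
  rcases Nat.eq_zero_or_pos k with rfl | hk
  · simp [binDeviance, hr.le]
  · have hk' : (0 : ℝ) < k := by exact_mod_cast hk
    have h := Real.log_le_sub_one_of_pos (div_pos hr hk')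
    rw [Real.log_div hr.ne' hk'.ne'] at h
    have := mul_le_mul_of_nonneg_left h hk'.le
    have e : (k : ℝ) * (r / k - 1) = r - k := by field_simp
    rw [e] at this
    unfold binDeviance
    linarith

lemma abs_log_le {x : ℝ} (hx : 0 < x) : |Real.log x| ≤ x + x⁻¹ := by
  rw [abs_le]
  have h1 := Real.log_le_sub_one_of_pos hx
  have h2 := Real.log_le_sub_one_of_pos (inv_pos.2 hx)
  rw [Real.log_inv] at h2
  have := inv_pos.2 hx
  constructor <;> linarith

lemma abs_binDeviance_le {r ε M : ℝ} (hε : 0 < ε) (hr : ε ≤ r) (hM : r ≤ M) (k : ℕ) :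
    |binDeviance r k| ≤ (2 * M + ε⁻¹ + 1) * (1 + (k : ℝ) ^ 2) := by
  have hr0 : 0 < r := hε.trans_le hr
  rw [abs_of_nonneg (binDeviance_nonneg hr0 k)]
  have h1 : -Real.log r ≤ M + ε⁻¹ := by
    have := (neg_le_abs _).trans (abs_log_le hr0)
    have := inv_anti₀ hε hr
    linarith
  have hk0 : (0 : ℝ) ≤ k := by positivity
  have h2 : (k : ℝ) * Real.log k ≤ (k : ℝ) ^ 2 := by
    rw [sq]
    exact mul_le_mul_of_nonneg_left (Real.log_le_self hk0) hk0
  have h3 : (k : ℝ) ≤ 1 + (k : ℝ) ^ 2 := by nlinarith [sq_nonneg ((k : ℝ) - 1)]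
  have h4 := mul_le_mul_of_nonneg_left h1 hk0
  have hεi := inv_pos.2 hε
  have hM0 : 0 < M := hr0.trans_le hM
  have h5 := mul_le_mul_of_nonneg_left h3 (show 0 ≤ M + ε⁻¹ by positivity)
  have h6 : 0 ≤ M * (k : ℝ) ^ 2 := by positivity
  unfold binDeviance
  linarith

lemma binDeviance_second_difference (r : ℝ) :
    binDeviance r 0 - 2 * binDeviance r 1 + binDeviance r 2 = 2 * Real.log 2 := by
  simp only [binDeviance]
  push_cast
  simp
  ring

lemma log_pow_four_le {x : ℝ} (hx : 0 < x) : Real.log x ^ 4 ≤ 24 * (x + x⁻¹) := by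
  have h := Real.pow_div_factorial_le_exp |Real.log x| (abs_nonneg _) 4
  rw [div_le_iff₀ (by positivity), show |Real.log x| ^ 4 = Real.log x ^ 4 from
    Even.pow_abs (by decide) _] at h
  have hxi := inv_pos.2 hx
  have h2 : Real.exp |Real.log x| ≤ x + x⁻¹ := by
    rcases abs_choice (Real.log x) with h | h <;> rw [h]
    · rw [Real.exp_log hx]; linarith
    · rw [Real.exp_neg, Real.exp_log hx]; linarith
  norm_num [Nat.factorial] at h
  linarith

lemma natCast_mul_log_div_le {u s : ℝ} (hu : 0 < u) (hs : 0 < s) (k : ℕ) :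
    (k : ℝ) * Real.log (u / s) ≤ u / 2 + 2 * (k : ℝ) ^ 2 / s := by
  rcases Nat.eq_zero_or_pos k with rfl | hk
  · simp; positivity
  · have hk' : (0 : ℝ) < k := by exact_mod_cast hk
    have h1 := Real.log_le_sub_one_of_pos (show 0 < u / (2 * k) by positivity)
    have h2 := Real.log_le_sub_one_of_pos (show 0 < 2 * k / s by positivity)
    have e : Real.log (u / s) = Real.log (u / (2 * k)) + Real.log (2 * k / s) := by
      rw [← Real.log_mul (by positivity) (by positivity)]
      congr 1; field_simp
    have := mul_le_mul_of_nonneg_left (add_le_add h1 h2) hk'.le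
    rw [← e] at this
    refine this.trans ?_
    have e2 : (k : ℝ) * (u / (2 * k) - 1 + (2 * k / s - 1))
        = u / 2 + 2 * (k : ℝ) ^ 2 / s - 2 * k := by field_simp; ring
    rw [e2]
    linarith

section Gain

variable {n : ℕ}

/-- The drop of the `C` function when the rates `s` are replaced by `u`. -/
def gain (s u : Fin n → ℝ) (N : Fin n → ℕ) : ℝ :=
  2 * ∑ i, (s i - u i + N i * Real.log (u i / s i))

lemma gain_le {s u : Fin n → ℝ} (hs : ∀ i, 0 < s i) (hu : ∀ i, 0 < u i) (N : Fin n → ℕ) :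
    gain s u N ≤ 2 * ∑ i, (N i - s i) / s i * (u i - s i) := by
  unfold gain
  gcongr with i
  have h := Real.log_le_sub_one_of_pos (div_pos (hu i) (hs i))
  have := mul_le_mul_of_nonneg_left h (Nat.cast_nonneg (α := ℝ) (N i))
  have hsi := (hs i).ne'
  have e : (N i - s i) / s i * (u i - s i) = s i - u i + N i * (u i / s i - 1) := by
    field_simp
    ring
  rw [e]
  linarith

lemma sum_le_of_gain_nonneg {s u : Fin n → ℝ} {ε M : ℝ} (hε : 0 < ε) (hs : ∀ i, ε ≤ s i)
    (hM : ∀ i, s i ≤ M) (hu : ∀ i, 0 < u i) {N : Fin n → ℕ} (hN : 0 ≤ gain s u N) :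
    ∑ i, u i ≤ ∑ i, (2 * M + 4 * ε⁻¹ * (N i : ℝ) ^ 2) := by
  have h : ∑ i, (s i - u i + N i * Real.log (u i / s i))
      ≤ ∑ i, (M + 2 * ε⁻¹ * (N i : ℝ) ^ 2 - u i / 2) := by
    refine Finset.sum_le_sum fun i _ => ?_
    have h1 := natCast_mul_log_div_le (hu i) (hε.trans_le (hs i)) (N i)
    have h2 : 2 * (N i : ℝ) ^ 2 / s i ≤ 2 * ε⁻¹ * (N i : ℝ) ^ 2 := by
      rw [div_eq_mul_inv, mul_right_comm]
      have := inv_anti₀ hε (hs i)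
      gcongr
    linarith [hM i]
  have h0 : 0 ≤ ∑ i, (M + 2 * ε⁻¹ * (N i : ℝ) ^ 2 - u i / 2) := by
    unfold gain at hN; linarith
  rw [Finset.sum_sub_distrib, ← Finset.sum_div] at h0
  have e : ∑ i, (2 * M + 4 * ε⁻¹ * (N i : ℝ) ^ 2)
      = 2 * ∑ i, (M + 2 * ε⁻¹ * (N i : ℝ) ^ 2) := by
    rw [Finset.mul_sum]
    exact Finset.sum_congr rfl fun i _ => by ring
  rw [e]
  linarith

lemma gain_sub_gain_update (s u : Fin n → ℝ) (N N' : Fin n → ℕ) (i : Fin n)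
    (h : ∀ j, j ≠ i → N j = N' j) :
    gain s u N - gain s u N' = 2 * ((N i - N' i : ℝ) * Real.log (u i / s i)) := by
  unfold gain
  rw [← mul_sub, ← Finset.sum_sub_distrib, Finset.sum_eq_single i]
  · ring
  · intro j _ hj
    rw [h j hj]; ring
  · simp

/-- The increments of a maximal gain under changes of one count. -/
lemma sum_sq_increment_le {s : Fin n → ℝ} {u : (Fin n → ℕ) → Fin n → ℝ} {ε M : ℝ} (hε : 0 < ε)
    (hs : ∀ i, ε ≤ s i) (hM : ∀ i, s i ≤ M) (hu : ∀ N i, ε ≤ u N i)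
    (hmax : ∀ N N', gain s (u N') N ≤ gain s (u N) N) (h0 : ∀ N, 0 ≤ gain s (u N) N)
    (N : Fin n → ℕ) (N' : Fin n → Fin n → ℕ) (hN' : ∀ i j, j ≠ i → N j = N' i j) :
    ∑ i, (max (gain s (u N) N - gain s (u (N' i)) (N' i)) 0) ^ 2
      ≤ ∑ i, (48 * ε⁻¹ * (3 * M + 4 * ε⁻¹) + 2) * (1 + (N i : ℝ) ^ 4 + (N' i i : ℝ) ^ 4) := by
  have hεi := inv_pos.2 hε
  have hterm (i : Fin n) : (max (gain s (u N) N - gain s (u (N' i)) (N' i)) 0) ^ 2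
      ≤ 48 * ε⁻¹ * (u N i + M) + 2 * ((N i : ℝ) ^ 4 + (N' i i : ℝ) ^ 4) := by
    set h := Real.log (u N i / s i) with hh
    have hsi : 0 < s i := hε.trans_le (hs i)
    have hui : 0 < u N i := hε.trans_le (hu N i)
    have h1 : max (gain s (u N) N - gain s (u (N' i)) (N' i)) 0
        ≤ |2 * ((N i - N' i i : ℝ) * h)| := by
      refine max_le ?_ (abs_nonneg _)
      rw [hh, ← gain_sub_gain_update s (u N) N (N' i) i (hN' i)]
      refine le_trans ?_ (le_abs_self _)
      linarith [hmax (N' i) N]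
    have h2 : (max (gain s (u N) N - gain s (u (N' i)) (N' i)) 0) ^ 2
        ≤ (2 * ((N i - N' i i : ℝ) * h)) ^ 2 := by
      rw [← sq_abs (2 * _)]
      exact pow_le_pow_left₀ (le_max_right _ _) h1 2
    have h3 : h ^ 4 ≤ 24 * ε⁻¹ * (u N i + M) := by
      refine (log_pow_four_le (div_pos hui hsi)).trans ?_
      have k1 : u N i / s i ≤ ε⁻¹ * u N i := by
        rw [div_eq_mul_inv, mul_comm]
        have := inv_anti₀ hε (hs i)
        gcongr
      have k2 : (u N i / s i)⁻¹ ≤ ε⁻¹ * M := by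
        rw [inv_div, div_eq_mul_inv, mul_comm]
        have := inv_anti₀ hε (hu N i)
        have := hM i
        gcongr
      linarith
    have h4 : (N i - N' i i : ℝ) ^ 4 ≤ (N i : ℝ) ^ 4 + (N' i i : ℝ) ^ 4 := by
      have a0 : (0 : ℝ) ≤ N i := by positivity
      have b0 : (0 : ℝ) ≤ N' i i := by positivity
      rcases le_total (N i : ℝ) (N' i i) with hab | hab
      · have : (N i - N' i i : ℝ) ^ 4 = (N' i i - N i : ℝ) ^ 4 := by ring
        rw [this]
        have := pow_le_pow_left₀ (sub_nonneg.2 hab)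
          (show (N' i i - N i : ℝ) ≤ N' i i by linarith) 4
        have := pow_nonneg a0 4
        linarith
      · have := pow_le_pow_left₀ (sub_nonneg.2 hab)
          (show (N i - N' i i : ℝ) ≤ N i by linarith) 4
        have := pow_nonneg b0 4
        linarith
    nlinarith [sq_nonneg ((N i - N' i i : ℝ) ^ 2 - h ^ 2)]
  have hsum := sum_le_of_gain_nonneg hε hs hM (fun i => hε.trans_le (hu N i)) (h0 N)
  calc _ ≤ ∑ i, (48 * ε⁻¹ * (u N i + M) + 2 * ((N i : ℝ) ^ 4 + (N' i i : ℝ) ^ 4)) :=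
        Finset.sum_le_sum fun i _ => hterm i
    _ = 48 * ε⁻¹ * ∑ i, u N i + ∑ i, (48 * ε⁻¹ * M + 2 * ((N i : ℝ) ^ 4 + (N' i i : ℝ) ^ 4)) := by
        rw [Finset.mul_sum, ← Finset.sum_add_distrib]
        exact Finset.sum_congr rfl fun i _ => by ring
    _ ≤ 48 * ε⁻¹ * ∑ i, (2 * M + 4 * ε⁻¹ * (N i : ℝ) ^ 2)
        + ∑ i, (48 * ε⁻¹ * M + 2 * ((N i : ℝ) ^ 4 + (N' i i : ℝ) ^ 4)) := by gcongr
    _ ≤ _ := by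
        rw [Finset.mul_sum, ← Finset.sum_add_distrib]
        refine Finset.sum_le_sum fun i _ => ?_
        have hM0 : 0 ≤ M := hε.le.trans ((hs i).trans (hM i))
        have q1 : (N i : ℝ) ^ 2 ≤ 1 + (N i : ℝ) ^ 4 := by
          nlinarith [sq_nonneg ((N i : ℝ) ^ 2 - 1), sq_nonneg ((N i : ℝ) ^ 2)]
        have q2 : 0 ≤ ε⁻¹ * M * ((N i : ℝ) ^ 4 + (N' i i : ℝ) ^ 4) := by positivity
        have q3 : 0 ≤ ε⁻¹ * ε⁻¹ * (N' i i : ℝ) ^ 4 := by positivity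
        have q4 := mul_le_mul_of_nonneg_left q1 (show 0 ≤ ε⁻¹ * ε⁻¹ by positivity)
        nlinarith

end Gain

end PoissonBins

/-- A nonnegative variable which exceeds `t` with probability at most one half is controlled in
`L²` by `t` and the variance of its excess over `t`. -/
lemma integral_sq_le_of_measure_excess_le {Ω : Type*} [MeasurableSpace Ω] {μ : Measure Ω}
    [IsProbabilityMeasure μ] {f : Ω → ℝ} (hf : MemLp f 2 μ) (hfm : Measurable f)
    (h0 : ∀ ω, 0 ≤ f ω) {t : ℝ} (hp : μ.real {ω | t < f ω} ≤ 1 / 2) :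
    ∫ ω, f ω ^ 2 ∂μ ≤ 2 * t ^ 2 + 4 * Var[fun ω => max (f ω - t) 0; μ] := by
  set g : Ω → ℝ := fun ω => max (f ω - t) 0 with hg
  have hgL : MemLp g 2 μ := by simpa using (hf.sub (memLp_const t)).pos_part
  have hset : MeasurableSet {ω | t < f ω} := measurableSet_lt measurable_const hfm
  have hmean : (∫ ω, g ω ∂μ) ^ 2 ≤ (∫ ω, g ω ^ 2 ∂μ) * μ.real {ω | t < f ω} := by
    have hind : MemLp ({ω | t < f ω}.indicator fun _ => (1 : ℝ)) 2 μ :=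
      (memLp_const (1 : ℝ)).indicator hset
    have h := sq_integral_mul_le hgL hind
    have e1 : ∫ ω, g ω * ({ω | t < f ω}.indicator (fun _ => (1 : ℝ)) ω) ∂μ = ∫ ω, g ω ∂μ := by
      refine integral_congr_ae (ae_of_all _ fun ω => ?_)
      by_cases h : t < f ω
      · simp [h]
      · simp [h, hg, le_of_not_gt h]
    have e2 : ∫ ω, ({ω | t < f ω}.indicator (fun _ => (1 : ℝ)) ω) ^ 2 ∂μ
        = μ.real {ω | t < f ω} := by
      rw [← integral_indicator_one hset]
      refine integral_congr_ae (ae_of_all _ fun ω => ?_)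
      by_cases h : t < f ω <;> simp [h]
    rwa [e1, e2] at h
  have hv : Var[g; μ] = ∫ ω, g ω ^ 2 ∂μ - (∫ ω, g ω ∂μ) ^ 2 := by
    rw [variance_eq_sub hgL]; rfl
  have hg2 : 0 ≤ ∫ ω, g ω ^ 2 ∂μ := integral_nonneg fun _ => sq_nonneg _
  have hle : ∫ ω, g ω ^ 2 ∂μ ≤ 2 * Var[g; μ] := by nlinarith
  have hfg : ∫ ω, f ω ^ 2 ∂μ ≤ ∫ ω, (2 * t ^ 2 + 2 * g ω ^ 2) ∂μ := by
    refine integral_mono hf.integrable_sq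
      ((integrable_const _).add (hgL.integrable_sq.const_mul 2)) fun ω => ?_
    simp only [hg]
    rcases le_total (f ω) t with h | h
    · rw [max_eq_right (by linarith)]
      nlinarith [h0 ω]
    · rw [max_eq_left (by linarith)]
      nlinarith [sq_nonneg (t - (f ω - t))]
  rw [integral_add (integrable_const _) (hgL.integrable_sq.const_mul 2),
    integral_const_mul (2 : ℝ) fun ω => g ω ^ 2, integral_const] at hfg
  simp only [probReal_univ, one_smul] at hfg
  linarith

namespace PoissonBins

open EfronStein

variable {n : ℕ} {r : Fin n → ℝ≥0}

lemma memLp_pow_poisson (ρ : ℝ≥0) (p : ℕ) :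
    MemLp (fun k : ℕ => (k : ℝ) ^ p) 2 (poissonMeasure ρ) :=
  memLp_two_poisson_of_le_pow (K := 1) (p := p) fun k => by
    rw [abs_of_nonneg (by positivity)]; linarith

/-- The variance of the excess of a maximal gain over a level. -/
theorem variance_excess_gain_le {ε M : ℝ} (hε : 0 < ε) (hr : ∀ i, ε ≤ r i)
    (hM : ∀ i, (r i : ℝ) ≤ M) {u : (Fin n → ℕ) → Fin n → ℝ} (hu : ∀ N i, ε ≤ u N i)
    (hmax : ∀ N N', gain (fun i => (r i : ℝ)) (u N') N ≤ gain (fun i => (r i : ℝ)) (u N) N)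
    (h0 : ∀ N, 0 ≤ gain (fun i => (r i : ℝ)) (u N) N)
    (hL : MemLp (fun N => gain (fun i => (r i : ℝ)) (u N) N) 2
      (Measure.pi fun i => poissonMeasure (r i))) (t : ℝ) :
    Var[fun N => max (gain (fun i => (r i : ℝ)) (u N) N - t) 0;
        Measure.pi fun i => poissonMeasure (r i)]
      ≤ (48 * ε⁻¹ * (3 * M + 4 * ε⁻¹) + 2)
          * Real.sqrt (3 * (1 + 2 * ((1 + (8).factorial) * Real.exp (2 * M)))) * n
        * Real.sqrt ((Measure.pi fun i => poissonMeasure (r i)).real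
            {N | t < gain (fun i => (r i : ℝ)) (u N) N}) := by
  rcases Nat.eq_zero_or_pos n with rfl | hn
  · simp [variance, evariance, gain]
  have hM0 : 0 ≤ M := (r ⟨0, hn⟩).coe_nonneg.trans (hM _)
  have hεi := inv_pos.2 hε
  set A := 48 * ε⁻¹ * (3 * M + 4 * ε⁻¹) + 2 with hA
  have hA0 : 0 < A := by positivity
  set B := (1 + ((8).factorial : ℝ)) * Real.exp (2 * M) with hB
  set μ : Fin n → Measure ℕ := fun i => poissonMeasure (r i) with hμ
  set f : (Fin n → ℕ) → ℝ := fun N => gain (fun i => (r i : ℝ)) (u N) N with hf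
  let W (z : Fin n → ℕ × ℕ) : ℝ := ∑ i, A * (1 + ((z i).1 : ℝ) ^ 4 + ((z i).2 : ℝ) ^ 4)
  have hW (z : Fin n → ℕ × ℕ) : ∑ i : Fin n, (max (f (mix (fun _ => False) z)
      - f (mix (fun j => j = i) z)) 0) ^ 2 ≤ W z := by
    refine (sum_sq_increment_le hε hr hM hu hmax h0 (mix (fun _ => False) z)
      (fun i => mix (fun j => j = i) z) fun i j hj => by simp [mix, hj]).trans_eq ?_
    simp [W, mix, hA]
  have hpow (p : ℕ) (q : Fin n → Prop) [DecidablePred q] (i : Fin n) :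
      MemLp (fun z : Fin n → ℕ × ℕ => ((mix q z i : ℕ) : ℝ) ^ p) 2 (twoCopies μ) :=
    ((memLp_pow_poisson (r i) p).comp_measurePreserving
      (measurePreserving_eval μ i)).comp_measurePreserving (measurePreserving_mix μ q)
  have hWL : MemLp W 2 (twoCopies μ) := by
    refine memLp_finsetSum _ fun i _ => MemLp.const_mul ?_ A
    have := ((memLp_const (1 : ℝ)).add (hpow 4 (fun _ => False) i)).add (hpow 4 (fun _ => True) i)
    simpa [mix] using! this
  have hmom (q : Fin n → Prop) [DecidablePred q] (i : Fin n) :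
      ∫ z : Fin n → ℕ × ℕ, ((mix q z i : ℕ) : ℝ) ^ 8 ∂(twoCopies μ) ≤ B := by
    rw [integral_comp_mix q (F := fun N : Fin n → ℕ => (N i : ℝ) ^ 8) .of_discrete,
      integral_comp_eval (μ := μ) (f := fun k : ℕ => (k : ℝ) ^ 8) .of_discrete]
    have := integral_poisson_le_of_le_pow (r := r i) (f := fun k : ℕ => (k : ℝ) ^ 8) (K := 1)
      (p := 8) zero_le_one (hM i) fun k => by rw [abs_of_nonneg (by positivity)]; linarith
    simpa [hB, hμ] using this
  have hW2 : ∫ z, W z ^ 2 ∂(twoCopies μ) ≤ (A * Real.sqrt (3 * (1 + 2 * B)) * n) ^ 2 := by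
    have hpt (z : Fin n → ℕ × ℕ) : W z ^ 2 ≤ n * (A ^ 2 * 3) * ∑ i : Fin n,
        (1 + ((mix (fun _ => False) z i : ℕ) : ℝ) ^ 8 + ((mix (fun _ => True) z i : ℕ) : ℝ) ^ 8) := by
      have h1 := sq_sum_le_card_mul_sum_sq (s := (Finset.univ : Finset (Fin n)))
        (f := fun i => A * (1 + ((z i).1 : ℝ) ^ 4 + ((z i).2 : ℝ) ^ 4))
      refine h1.trans ?_
      rw [Finset.card_fin, mul_assoc (n : ℝ) (A ^ 2 * 3), Finset.mul_sum _ _ (A ^ 2 * 3)]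
      refine mul_le_mul_of_nonneg_left (Finset.sum_le_sum fun i _ => ?_) (n.cast_nonneg (α := ℝ))
      simp only [mix, if_true, if_false]
      rw [mul_pow, mul_assoc]
      gcongr
      nlinarith [sq_nonneg (((z i).1 : ℝ) ^ 4 - 1), sq_nonneg (((z i).2 : ℝ) ^ 4 - 1),
        sq_nonneg (((z i).1 : ℝ) ^ 4 - ((z i).2 : ℝ) ^ 4)]
    have hi (q : Fin n → Prop) [DecidablePred q] (i : Fin n) :
        Integrable (fun z : Fin n → ℕ × ℕ => ((mix q z i : ℕ) : ℝ) ^ 8) (twoCopies μ) :=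
      (hpow 8 q i).integrable (by norm_num)
    have hi2 (i : Fin n) : Integrable (fun z : Fin n → ℕ × ℕ =>
        (1 : ℝ) + ((mix (fun _ => False) z i : ℕ) : ℝ) ^ 8) (twoCopies μ) :=
      (integrable_const _).add (hi _ i)
    have hi3 (i : Fin n) : Integrable (fun z : Fin n → ℕ × ℕ => (1 : ℝ)
        + ((mix (fun _ => False) z i : ℕ) : ℝ) ^ 8 + ((mix (fun _ => True) z i : ℕ) : ℝ) ^ 8)
        (twoCopies μ) := (hi2 i).add (hi _ i)
    have hB0 : 0 ≤ B := by positivity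
    calc ∫ z, W z ^ 2 ∂(twoCopies μ)
        ≤ ∫ z, n * (A ^ 2 * 3) * ∑ i : Fin n, (1 + ((mix (fun _ => False) z i : ℕ) : ℝ) ^ 8
          + ((mix (fun _ => True) z i : ℕ) : ℝ) ^ 8) ∂(twoCopies μ) :=
          integral_mono hWL.integrable_sq
            ((integrable_finsetSum _ fun i _ => hi3 i).const_mul _) hpt
      _ = n * (A ^ 2 * 3) * ∑ i : Fin n, (1 + ∫ z, ((mix (fun _ => False) z i : ℕ) : ℝ) ^ 8
            ∂(twoCopies μ) + ∫ z, ((mix (fun _ => True) z i : ℕ) : ℝ) ^ 8 ∂(twoCopies μ)) := by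
          rw [integral_const_mul, integral_finsetSum _ fun i _ => hi3 i]
          congr 1
          refine Finset.sum_congr rfl fun i _ => ?_
          rw [integral_add (hi2 i) (hi _ i), integral_add (integrable_const _) (hi _ i)]
          simp
      _ ≤ n * (A ^ 2 * 3) * ∑ i : Fin n, (1 + B + B) := by
          gcongr with i
          · exact hmom _ i
          · exact hmom _ i
      _ = (A * Real.sqrt (3 * (1 + 2 * B)) * n) ^ 2 := by
          rw [mul_pow, mul_pow, Real.sq_sqrt (by positivity)]
          simp
          ring
  let χ : (Fin n → ℕ × ℕ) → ℝ := fun z => if t < f (mix (fun _ => False) z) then 1 else 0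
  have hχ : MemLp χ 2 (twoCopies μ) := by
    refine MemLp.of_bound .of_discrete 1 (ae_of_all _ fun z => ?_)
    simp only [χ]; split_ifs <;> simp
  have hχW (z : Fin n → ℕ × ℕ) :
      (if t < f (mix (fun _ => False) z) then W z else 0) = χ z * W z := by
    simp only [χ]; split_ifs <;> simp
  refine (variance_excess_le hL t hW ?_).trans ?_
  · simp_rw [hχW]
    exact hχ.integrable_mul hWL
  · simp_rw [hχW]
    refine (integral_mul_le_sqrt hχ hWL).trans ?_
    rw [mul_comm]
    have h1 : Real.sqrt (∫ z, W z ^ 2 ∂(twoCopies μ)) ≤ A * Real.sqrt (3 * (1 + 2 * B)) * n :=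
      Real.sqrt_le_iff.2 ⟨by positivity, hW2⟩
    have h2 : ∫ z, χ z ^ 2 ∂(twoCopies μ) = (Measure.pi μ).real {N | t < f N} := by
      have h3 : ∀ z, χ z ^ 2 = ({N | t < f N}.indicator 1 (mix (fun _ => False) z) : ℝ) := by
        intro z
        simp only [χ, Set.indicator, Set.mem_ofPred_eq, Pi.one_apply]
        split_ifs <;> simp
      simp_rw [h3]
      rw [integral_comp_mix (fun _ => False)
        (F := fun N => ({N | t < f N}.indicator 1 N : ℝ)) .of_discrete,
        integral_indicator_one .of_discrete]
    rw [h2]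
    gcongr

end PoissonBins

/-- A sequence converging in distribution is bounded in probability. -/
lemma exists_measure_norm_gt_lt {Ω : ℕ → Type*} [∀ n, MeasurableSpace (Ω n)]
    {μ : (n : ℕ) → Measure (Ω n)} [∀ n, IsProbabilityMeasure (μ n)]
    {Ω' : Type*} [MeasurableSpace Ω'] {P : Measure Ω'} [IsProbabilityMeasure P]
    {E : Type*} [NormedAddCommGroup E] [ProperSpace E]
    [MeasurableSpace E] [BorelSpace E] {X : (n : ℕ) → Ω n → E} {Z : Ω' → E}
    (h : TendstoInDistribution X atTop Z μ P) {η : ℝ} (hη : 0 < η) :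
    ∃ K > 0, ∀ᶠ n in atTop, (μ n).real {ω | K < ‖X n ω‖} < η := by
  have hP : IsProbabilityMeasure (P.map Z) :=
    Measure.isProbabilityMeasure_map h.aemeasurable_limit
  have ht : Tendsto (fun K : ℝ => (P.map Z) {x | K ≤ ‖x‖}) atTop (𝓝 0) := by
    have h1 := tendsto_measure_norm_gt_of_isTightMeasureSet
      (isTightMeasureSet_singleton (μ := P.map Z))
    simp only [Set.mem_singleton_iff, iSup_iSup_eq_left] at h1
    have h2 := h1.comp (tendsto_atTop_add_const_right atTop (-1 : ℝ) tendsto_id)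
    refine tendsto_of_tendsto_of_tendsto_of_le_of_le tendsto_const_nhds h2 (fun _ => zero_le)
      fun K => measure_mono fun x hx => ?_
    simp only [Set.mem_ofPred_eq, id] at hx ⊢
    linarith
  obtain ⟨K, hK, hK0⟩ := ((ht.eventually_lt_const (ENNReal.ofReal_pos.2 hη)).and
    (eventually_gt_atTop 0)).exists
  refine ⟨K, hK0, ?_⟩
  have hcl : IsClosed {x : E | K ≤ ‖x‖} := isClosed_le continuous_const continuous_norm
  have hlim := ProbabilityMeasure.limsup_measure_closed_le_of_tendsto h.tendsto hcl
  have hev := eventually_lt_of_limsup_lt (hlim.trans_lt hK)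
  filter_upwards [hev] with n hn
  rw [measureReal_def]
  refine ENNReal.toReal_lt_of_lt_ofReal (lt_of_le_of_lt ?_ hn)
  simp only [ProbabilityMeasure.coe_mk]
  rw [Measure.map_apply_of_aemeasurable (h.forall_aemeasurable n) hcl.measurableSet]
  refine measure_mono fun ω hω => ?_
  simp only [Set.mem_ofPred_eq, Set.mem_preimage] at hω ⊢
  exact hω.le

namespace PoissonBins

variable {d n : ℕ}

lemma norm_gradient_le {s : EuclideanSpace ℝ (Fin d) → ℝ≥0} {θ₀ G : EuclideanSpace ℝ (Fin d)}
    {M ρ : ℝ} (hM : (s θ₀ : ℝ) ≤ M) (hρ : 0 < ρ)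
    (h : ∀ θ, ‖θ - θ₀‖ < ρ → |(s θ : ℝ) - s θ₀ - inner ℝ G (θ - θ₀)| ≤ 1 * ‖θ - θ₀‖) :
    ‖G‖ ≤ 1 + 2 * M / ρ := by
  have hM0 : 0 ≤ M := (s θ₀).coe_nonneg.trans hM
  rcases eq_or_ne G 0 with rfl | hG
  · rw [norm_zero]; positivity
  have hG0 : 0 < ‖G‖ := norm_pos_iff.2 hG
  have hn : ‖(θ₀ + (-(ρ / 2) / ‖G‖) • G) - θ₀‖ = ρ / 2 := by
    rw [add_sub_cancel_left, norm_smul, Real.norm_eq_abs, abs_div, abs_neg, abs_norm,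
      div_mul_cancel₀ _ hG0.ne', abs_of_pos (by positivity)]
  have h1 := (abs_le.1 (h (θ₀ + (-(ρ / 2) / ‖G‖) • G) (by rw [hn]; linarith))).2
  rw [hn, add_sub_cancel_left, inner_smul_right, real_inner_self_eq_norm_sq] at h1
  have e : -(ρ / 2) / ‖G‖ * ‖G‖ ^ 2 = -(ρ / 2) * ‖G‖ := by field_simp
  rw [e] at h1
  have h2 := (s (θ₀ + (-(ρ / 2) / ‖G‖) • G)).coe_nonneg
  have e2 : 1 + 2 * M / ρ = (ρ / 2 + M) / (ρ / 2) := by field_simp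
  rw [e2, le_div_iff₀ (by positivity)]
  linarith

/-- The score at the true rates `r` with gradients `G`. -/
def linearScore (r : Fin n → ℝ≥0) (G : Fin n → EuclideanSpace ℝ (Fin d)) (N : Fin n → ℕ) :
    EuclideanSpace ℝ (Fin d) :=
  ∑ i, (((N i : ℝ) - r i) / r i) • G i

/-- The total relative deviation of the counts from the rates `r`. -/
def totalDeviation (r : Fin n → ℝ≥0) (N : Fin n → ℕ) : ℝ := ∑ i, |((N i : ℝ) - r i) / r i|

lemma gain_le_of_linearization {r : Fin n → ℝ≥0} (hr : ∀ i, (0 : ℝ) < r i) {u : Fin n → ℝ}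
    (hu : ∀ i, 0 < u i) {G : Fin n → EuclideanSpace ℝ (Fin d)} {δ : EuclideanSpace ℝ (Fin d)}
    {c : ℝ} (h : ∀ i, |u i - r i - inner ℝ (G i) δ| ≤ c * ‖δ‖) (N : Fin n → ℕ) :
    gain (fun i => (r i : ℝ)) u N
      ≤ 2 * ‖δ‖ * (‖linearScore r G N‖ + c * totalDeviation r N) := by
  refine (gain_le hr hu N).trans ?_
  have h1 : ∑ i, ((N i : ℝ) - r i) / r i * (u i - r i)
      ≤ inner ℝ (linearScore r G N) δ + ∑ i, |((N i : ℝ) - r i) / r i| * (c * ‖δ‖) := by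
    rw [linearScore, sum_inner, ← Finset.sum_add_distrib]
    refine Finset.sum_le_sum fun i _ => ?_
    rw [real_inner_smul_left]
    have : ((N i : ℝ) - r i) / r i * (u i - r i - inner ℝ (G i) δ)
        ≤ |((N i : ℝ) - r i) / r i| * (c * ‖δ‖) := by
      refine (le_abs_self _).trans ?_
      rw [abs_mul]
      exact mul_le_mul_of_nonneg_left (h i) (abs_nonneg _)
    linarith
  rw [← Finset.sum_mul] at h1
  have h2 := real_inner_le_norm (linearScore r G N) δ
  unfold totalDeviation
  linarith

section Moments

variable {r : Fin n → ℝ≥0} {ε M B : ℝ} {G : Fin n → EuclideanSpace ℝ (Fin d)}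

lemma memLp_natCast_poisson (ρ : ℝ≥0) : MemLp (fun k : ℕ => (k : ℝ)) 2 (poissonMeasure ρ) :=
  memLp_two_poisson_of_le_pow (K := 1) (p := 1) fun k => by
    rw [abs_of_nonneg (by positivity)]; linarith

lemma integral_natCast_sub_div_poisson (ρ : ℝ≥0) :
    ∫ k : ℕ, ((k : ℝ) - ρ) / ρ ∂(poissonMeasure ρ) = 0 := by
  rw [integral_div, integral_sub ((memLp_natCast_poisson ρ).integrable (by norm_num))
    (integrable_const _), integral_natCast_poisson]
  simp

lemma variance_natCast_poisson_le {ρ : ℝ≥0} (hM : (ρ : ℝ) ≤ M) :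
    Var[fun k : ℕ => (k : ℝ); poissonMeasure ρ] ≤ 3 * Real.exp (2 * M) := by
  refine (variance_le_expectation_sq (memLp_natCast_poisson ρ).aestronglyMeasurable).trans ?_
  have := integral_poisson_le_of_le_pow (r := ρ) (f := fun k : ℕ => (k : ℝ) ^ 2) (K := 1) (p := 2)
    zero_le_one hM fun k => by rw [abs_of_nonneg (by positivity)]; linarith
  refine this.trans_eq ?_
  norm_num [Nat.factorial]

lemma integral_sq_linearScore_coord (hε : 0 < ε) (hr : ∀ i, ε ≤ r i) (hM : ∀ i, (r i : ℝ) ≤ M)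
    (a : Fin d) :
    MemLp (fun N => linearScore r G N a) 2 (Measure.pi fun i => poissonMeasure (r i)) ∧
    ∫ N, linearScore r G N a ^ 2 ∂(Measure.pi fun i => poissonMeasure (r i))
      ≤ ∑ i, G i a ^ 2 * (3 * Real.exp (2 * M) / ε ^ 2) := by
  let ζ (i : Fin n) (k : ℕ) : ℝ := ((k : ℝ) - r i) / r i * G i a
  have hζ i : MemLp (ζ i) 2 (poissonMeasure (r i)) := by
    have : MemLp (fun k : ℕ => ((k : ℝ) - r i) * ((r i : ℝ)⁻¹ * G i a)) 2 (poissonMeasure (r i)) :=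
      ((memLp_natCast_poisson (r i)).sub (memLp_const (r i : ℝ))).mul_const _
    simpa [ζ, div_eq_mul_inv, mul_assoc] using this
  have hcoord (N : Fin n → ℕ) : linearScore r G N a = ∑ i, ζ i (N i) := by
    simp [linearScore, ζ]
  have hL i : MemLp (fun N : Fin n → ℕ => ζ i (N i)) 2
      (Measure.pi fun i => poissonMeasure (r i)) :=
    (hζ i).comp_measurePreserving
      (measurePreserving_eval (fun i => poissonMeasure (r i)) i)
  have hS : MemLp (fun N => linearScore r G N a) 2
      (Measure.pi fun i => poissonMeasure (r i)) := by
    simp_rw [hcoord]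
    exact memLp_finsetSum _ fun i _ => hL i
  refine ⟨hS, ?_⟩
  have hmean : ∫ N, linearScore r G N a ∂(Measure.pi fun i => poissonMeasure (r i)) = 0 := by
    simp_rw [hcoord]
    rw [integral_finsetSum _ fun i _ => (hL i).integrable (by norm_num)]
    refine Finset.sum_eq_zero fun i _ => ?_
    rw [integral_comp_eval (μ := fun i => poissonMeasure (r i)) (f := ζ i) .of_discrete]
    simp only [ζ]
    rw [integral_mul_const, integral_natCast_sub_div_poisson, zero_mul]
  have hvar : ∫ N, linearScore r G N a ^ 2 ∂(Measure.pi fun i => poissonMeasure (r i))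
      = ∑ i, Var[ζ i; poissonMeasure (r i)] := by
    rw [← variance_of_integral_eq_zero hS.aestronglyMeasurable.aemeasurable hmean,
      ← variance_sum_pi hζ]
    congr 1
    ext N
    simp [hcoord]
  rw [hvar]
  refine Finset.sum_le_sum fun i _ => ?_
  have e : ζ i = fun k : ℕ => ((k : ℝ) - r i) * (G i a / r i) := by
    ext k; simp only [ζ]; ring
  rw [e, variance_mul_const, variance_sub_const (memLp_natCast_poisson _).aestronglyMeasurable,
    div_pow, mul_comm, div_mul_eq_mul_div, mul_div_assoc]
  have := variance_natCast_poisson_le (hM i)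
  have := hr i
  gcongr

lemma integral_norm_linearScore_le (hε : 0 < ε) (hr : ∀ i, ε ≤ r i) (hM : ∀ i, (r i : ℝ) ≤ M)
    (hG : ∀ i, ‖G i‖ ≤ B) :
    Integrable (fun N => ‖linearScore r G N‖) (Measure.pi fun i => poissonMeasure (r i)) ∧
    ∫ N, ‖linearScore r G N‖ ∂(Measure.pi fun i => poissonMeasure (r i))
      ≤ Real.sqrt (B ^ 2 * (3 * Real.exp (2 * M) / ε ^ 2)) * Real.sqrt n := by
  have hco (a : Fin d) := integral_sq_linearScore_coord (G := G) hε hr hM a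
  have hsq (N : Fin n → ℕ) : ‖linearScore r G N‖ ^ 2 = ∑ a, linearScore r G N a ^ 2 :=
    EuclideanSpace.real_norm_sq_eq _
  have hL : MemLp (fun N => ‖linearScore r G N‖) 2
      (Measure.pi fun i => poissonMeasure (r i)) := by
    rw [memLp_two_iff_integrable_sq .of_discrete]
    simp_rw [hsq]
    exact integrable_finsetSum _ fun a _ => (hco a).1.integrable_sq
  refine ⟨hL.integrable (by norm_num), ?_⟩
  have h := integral_abs_le_sqrt hL
  simp only [abs_norm] at h
  refine h.trans ?_
  rw [← Real.sqrt_mul (by positivity)]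
  refine Real.sqrt_le_sqrt ?_
  simp_rw [hsq]
  rw [integral_finsetSum _ fun a _ => (hco a).1.integrable_sq]
  calc _ ≤ ∑ a, ∑ i, G i a ^ 2 * (3 * Real.exp (2 * M) / ε ^ 2) :=
        Finset.sum_le_sum fun a _ => (hco a).2
    _ = ∑ i, ‖G i‖ ^ 2 * (3 * Real.exp (2 * M) / ε ^ 2) := by
        rw [Finset.sum_comm]
        refine Finset.sum_congr rfl fun i _ => ?_
        rw [← Finset.sum_mul, EuclideanSpace.real_norm_sq_eq]
    _ ≤ ∑ i : Fin n, B ^ 2 * (3 * Real.exp (2 * M) / ε ^ 2) := by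
        gcongr with i
        exact hG i
    _ = _ := by simp; ring

lemma integral_totalDeviation_le (hr : ∀ i, (0 : ℝ) < r i) :
    Integrable (totalDeviation r) (Measure.pi fun i => poissonMeasure (r i)) ∧
    ∫ N, totalDeviation r N ∂(Measure.pi fun i => poissonMeasure (r i)) ≤ 2 * n := by
  have hp (i : Fin n) : Integrable (fun k : ℕ => |((k : ℝ) - r i) / r i|)
      (poissonMeasure (r i)) :=
    (((memLp_natCast_poisson (r i)).sub (memLp_const (r i : ℝ))).integrable
      (by norm_num)).div_const _ |>.abs
  have hL (i : Fin n) : Integrable (fun N : Fin n → ℕ => |((N i : ℝ) - r i) / r i|)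
      (Measure.pi fun i => poissonMeasure (r i)) :=
    integrable_comp_eval (μ := fun i => poissonMeasure (r i)) (hp i)
  refine ⟨integrable_finsetSum _ fun i _ => hL i, ?_⟩
  unfold totalDeviation
  rw [integral_finsetSum _ fun i _ => hL i]
  calc _ ≤ ∑ i : Fin n, (2 : ℝ) := by
        refine Finset.sum_le_sum fun i _ => ?_
        rw [integral_comp_eval (μ := fun i => poissonMeasure (r i))
          (f := fun k : ℕ => |((k : ℝ) - r i) / r i|) .of_discrete]
        have hi : Integrable (fun k : ℕ => (k : ℝ) / r i) (poissonMeasure (r i)) :=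
          ((memLp_natCast_poisson (r i)).integrable (by norm_num)).div_const _
        calc _ ≤ ∫ k : ℕ, ((k : ℝ) / r i + 1) ∂(poissonMeasure (r i)) := by
              refine integral_mono (hp i) (hi.add (integrable_const _)) fun k => ?_
              have hri := hr i
              simp only
              rw [sub_div, div_self hri.ne', abs_le]
              have : 0 ≤ (k : ℝ) / r i := by positivity
              constructor <;> linarith
          _ = 2 := by
              rw [integral_add hi (integrable_const _), integral_div, integral_natCast_poisson,
                div_self (hr i).ne']
              norm_num
    _ = 2 * n := by simp; ring

end Moments

section CFun

variable {d n : ℕ} {s : Fin n → EuclideanSpace ℝ (Fin d) → ℝ≥0}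

lemma cFun_eq_sum_binDeviance (θ : EuclideanSpace ℝ (Fin d)) (N : Fin n → ℕ) :
    cFun s θ N = ∑ i, 2 * binDeviance (s i θ) (N i) := by
  rw [cFun, Finset.mul_sum]
  rfl

lemma cFun_nonneg {θ : EuclideanSpace ℝ (Fin d)} (hθ : ∀ i, (0 : ℝ) < s i θ) (N : Fin n → ℕ) :
    0 ≤ cFun s θ N := by
  rw [cFun_eq_sum_binDeviance]
  exact Finset.sum_nonneg fun i _ => mul_nonneg zero_le_two (binDeviance_nonneg (hθ i) _)

lemma cFun_sub_cFun {θ θ' : EuclideanSpace ℝ (Fin d)} (hθ : ∀ i, (0 : ℝ) < s i θ)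
    (hθ' : ∀ i, (0 : ℝ) < s i θ') (N : Fin n → ℕ) :
    cFun s θ N - cFun s θ' N = gain (fun i => (s i θ : ℝ)) (fun i => (s i θ' : ℝ)) N := by
  rw [cFun, cFun, gain, ← mul_sub, ← Finset.sum_sub_distrib]
  congr 1
  refine Finset.sum_congr rfl fun i _ => ?_
  rw [Real.log_div (hθ' i).ne' (hθ i).ne']
  ring

lemma likelihood_pos {θ : EuclideanSpace ℝ (Fin d)} (hθ : ∀ i, (0 : ℝ) < s i θ)
    (N : Fin n → ℕ) : 0 < likelihood s θ N := by
  refine Finset.prod_pos fun i _ => ?_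
  have := hθ i
  unfold pmf
  positivity

lemma cFun_eq_log_likelihood {θ : EuclideanSpace ℝ (Fin d)} (hθ : ∀ i, (0 : ℝ) < s i θ)
    (N : Fin n → ℕ) :
    cFun s θ N = -2 * Real.log (likelihood s θ N)
      + 2 * ∑ i, ((N i : ℝ) * Real.log (N i) - N i - Real.log (N i).factorial) := by
  have hp i : pmf (s i θ) (N i) ≠ 0 := by
    have := hθ i
    unfold pmf
    positivity
  rw [likelihood, Real.log_prod fun i _ => hp i, cFun, neg_mul, ← mul_neg, ← mul_add,
    ← Finset.sum_neg_distrib, ← Finset.sum_add_distrib]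
  congr 1
  refine Finset.sum_congr rfl fun i _ => ?_
  have := hθ i
  rw [pmf, Real.log_div (by positivity) (by positivity), Real.log_mul (by positivity)
    (by positivity), Real.log_exp, Real.log_pow]
  ring

/-- A maximum likelihood estimator minimizes the `C` function. -/
lemma IsMLE.cFun_le {Θ : Set (EuclideanSpace ℝ (Fin d))}
    {θhat : (Fin n → ℕ) → EuclideanSpace ℝ (Fin d)} (h : IsMLE Θ s θhat)
    (hpos : ∀ i, ∀ θ ∈ Θ, (0 : ℝ) < s i θ) {θ : EuclideanSpace ℝ (Fin d)} (hθ : θ ∈ Θ)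
    (N : Fin n → ℕ) : cFun s (θhat N) N ≤ cFun s θ N := by
  obtain ⟨h1, h2⟩ := h N
  rw [cFun_eq_log_likelihood (fun i => hpos i _ h1), cFun_eq_log_likelihood (fun i => hpos i _ hθ)]
  have := Real.log_le_log (likelihood_pos (fun i => hpos i _ hθ) N) (h2 θ hθ)
  linarith

lemma memLp_binDeviance {ε M : ℝ} (hε : 0 < ε) {r : ℝ≥0} (hr : ε ≤ r) (hM : (r : ℝ) ≤ M) :
    MemLp (fun k => 2 * binDeviance r k) 2 (poissonMeasure r) :=
  (memLp_two_poisson_of_le_pow (abs_binDeviance_le hε hr hM)).const_mul 2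

lemma memLp_cFun {ε M : ℝ} (hε : 0 < ε) {θ : EuclideanSpace ℝ (Fin d)}
    (hθ : ∀ i, ε ≤ s i θ) (hM : ∀ i, (s i θ : ℝ) ≤ M) : MemLp (cFun s θ) 2 (countLaw s θ) := by
  have : cFun s θ = fun N : Fin n → ℕ => ∑ i, 2 * binDeviance (s i θ) (N i) :=
    funext (cFun_eq_sum_binDeviance θ)
  rw [this]
  exact memLp_finsetSum _ fun i _ => (memLp_binDeviance hε (hθ i) (hM i)).comp_measurePreserving
    (measurePreserving_eval (fun i => poissonMeasure (s i θ)) i)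

lemma le_variance_binDeviance {ε M : ℝ} (hε : 0 < ε) {r : ℝ≥0} (hr : ε ≤ r)
    (hM : (r : ℝ) ≤ M) :
    Real.exp (-M) * min 1 (min ε (ε ^ 2 / 2)) * ((4 * Real.log 2) ^ 2 / 6)
      ≤ Var[fun k => 2 * binDeviance r k; poissonMeasure r] := by
  refine le_trans (le_of_eq ?_) (le_variance_poisson hε hr hM (memLp_binDeviance hε hr hM))
  congr 3
  linarith [binDeviance_second_difference r]

lemma third_moment_binDeviance_le {ε M : ℝ} (hε : 0 < ε) {r : ℝ≥0} (hr : ε ≤ r)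
    (hM : (r : ℝ) ≤ M) {A : ℝ}
    (hA : A = 2 * (2 * M + ε⁻¹ + 1) * (1 + 3 * Real.exp (2 * M))) :
    Integrable (fun k => |2 * binDeviance r k
      - ∫ j, 2 * binDeviance r j ∂(poissonMeasure r)| ^ 3) (poissonMeasure r) ∧
    ∫ k, |2 * binDeviance r k - ∫ j, 2 * binDeviance r j ∂(poissonMeasure r)| ^ 3
        ∂(poissonMeasure r) ≤ 4 * A ^ 3 * (1 + (6).factorial) * Real.exp (2 * M) := by
  set m := ∫ j, 2 * binDeviance r j ∂(poissonMeasure r) with hm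
  have hεi := inv_pos.2 hε
  have hM0 : 0 ≤ M := r.coe_nonneg.trans hM
  have hb (k : ℕ) : |2 * binDeviance r k| ≤ 2 * (2 * M + ε⁻¹ + 1) * (1 + (k : ℝ) ^ 2) := by
    rw [abs_mul, abs_two, mul_assoc]
    exact mul_le_mul_of_nonneg_left (abs_binDeviance_le hε hr hM k) zero_le_two
  have hm0 : 0 ≤ m := integral_nonneg fun k =>
    mul_nonneg zero_le_two (binDeviance_nonneg (hε.trans_le hr) k)
  have hm1 : m ≤ 2 * (2 * M + ε⁻¹ + 1) * (3 * Real.exp (2 * M)) := by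
    have := integral_poisson_le_of_le_pow (by positivity) hM hb
    refine this.trans_eq ?_
    norm_num [Nat.factorial]
    ring
  have hA0 : 0 ≤ A := by rw [hA]; positivity
  have hpt (k : ℕ) : |(|2 * binDeviance r k - m| ^ 3)| ≤ 4 * A ^ 3 * (1 + (k : ℝ) ^ 6) := by
    rw [abs_of_nonneg (by positivity)]
    have h1 : |2 * binDeviance r k - m| ≤ A * (1 + (k : ℝ) ^ 2) := by
      refine (abs_sub _ _).trans ?_
      rw [abs_of_nonneg hm0, hA]
      have h2 : m ≤ 2 * (2 * M + ε⁻¹ + 1) * (3 * Real.exp (2 * M)) * (1 + (k : ℝ) ^ 2) :=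
        hm1.trans (le_mul_of_one_le_right (by positivity) (by
          have : 0 ≤ (k : ℝ) ^ 2 := by positivity
          linarith))
      linarith [hb k]
    refine (pow_le_pow_left₀ (abs_nonneg _) h1 3).trans ?_
    rw [mul_pow, mul_comm (4 : ℝ), mul_assoc]
    gcongr
    set x := (k : ℝ) ^ 2
    have hx : 0 ≤ x := by positivity
    have e : (k : ℝ) ^ 6 = x ^ 3 := by simp only [x]; ring
    rw [e]
    nlinarith [mul_nonneg (add_nonneg zero_le_one hx) (sq_nonneg (x - 1))]
  exact ⟨integrable_poisson_of_le_pow (by positivity) hpt,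
    (integral_poisson_le_of_le_pow (by positivity) hM hpt)⟩

end CFun

section Asymptotics

variable {d : ℕ} {θstar : EuclideanSpace ℝ (Fin d)}
  {s : (n : ℕ) → Fin n → EuclideanSpace ℝ (Fin d) → ℝ≥0} {ε M : ℝ}

/-- The drop of the `C` function from the true parameter to an estimator with rate `√n` is
negligible compared to `√n` in probability. -/
theorem tendsto_measure_gain_gt (hsmooth : UniformlyDifferentiableAt s θstar) (hε : 0 < ε)
    (hr : ∀ n i, ε ≤ s n i θstar) (hM : ∀ n i, (s n i θstar : ℝ) ≤ M)
    {θhat : (n : ℕ) → (Fin n → ℕ) → EuclideanSpace ℝ (Fin d)}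
    (hu : ∀ n N i, (0 : ℝ) < s n i (θhat n N))
    (htight : ∀ η > 0, ∃ K > 0, ∀ᶠ n : ℕ in atTop, (countLaw (s n) θstar).real
      {N | K < ‖Real.sqrt n • (θhat n N - θstar)‖} < η) {a : ℝ} (ha : 0 < a) :
    Tendsto (fun n : ℕ => (countLaw (s n) θstar).real {N | a * Real.sqrt n
      < gain (fun i => (s n i θstar : ℝ)) (fun i => (s n i (θhat n N) : ℝ)) N}) atTop (𝓝 0) := by
  obtain ⟨G, hG⟩ := hsmooth
  obtain ⟨B, hB⟩ : ∃ B, ∀ n i, ‖G n i‖ ≤ B := by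
    obtain ⟨ρ, hρ, h⟩ := hG 1 one_pos
    exact ⟨1 + 2 * M / ρ, fun n i => norm_gradient_le (hM n i) hρ (h n i)⟩
  set C := Real.sqrt (B ^ 2 * (3 * Real.exp (2 * M) / ε ^ 2)) with hC
  have hC0 : 0 ≤ C := Real.sqrt_nonneg _
  rw [Metric.tendsto_atTop']
  suffices h : ∀ η > 0, ∀ᶠ n : ℕ in atTop, (countLaw (s n) θstar).real {N | a * Real.sqrt n
      < gain (fun i => (s n i θstar : ℝ)) (fun i => (s n i (θhat n N) : ℝ)) N} < η by
    intro η hη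
    obtain ⟨n₀, hn₀⟩ := eventually_atTop.1 (h η hη)
    refine ⟨n₀, fun n hn => ?_⟩
    rw [Real.dist_eq, sub_zero, abs_of_nonneg measureReal_nonneg]
    exact hn₀ n hn.le
  intro η hη
  obtain ⟨K, hK, hKev⟩ := htight (η / 3) (by positivity)
  set c := η * a / (12 * K) with hc
  have hc0 : 0 < c := by positivity
  obtain ⟨ρ, hρ, hlin⟩ := hG c hc0
  have hsqrt : Tendsto (fun n : ℕ => Real.sqrt n) atTop atTop :=
    Real.tendsto_sqrt_atTop.comp tendsto_natCast_atTop_atTop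
  have hev1 : ∀ᶠ n : ℕ in atTop, K / Real.sqrt n < ρ :=
    (hsqrt.const_div_atTop K).eventually_lt_const hρ
  have hev2 : ∀ᶠ n : ℕ in atTop, (2 * K * C / a) / Real.sqrt n < η / 3 :=
    (hsqrt.const_div_atTop _).eventually_lt_const (by positivity)
  filter_upwards [hKev, hev1, hev2, eventually_gt_atTop 0] with n h1 h2 h3 hn
  have hn0 : (0 : ℝ) < n := by exact_mod_cast hn
  have hsn : 0 < Real.sqrt n := Real.sqrt_pos.2 hn0
  set r : Fin n → ℝ≥0 := fun i => s n i θstar with hrdef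
  let Q (N : Fin n → ℕ) : ℝ := ‖linearScore r (G n) N‖ + c * totalDeviation r N
  have hS := integral_norm_linearScore_le (G := G n) hε (hr n) (hM n) (hB n)
  have hT := integral_totalDeviation_le (r := r) fun i => hε.trans_le (hr n i)
  have hSi : Integrable (fun N => ‖linearScore r (G n) N‖) (countLaw (s n) θstar) := hS.1
  have hTc : Integrable (fun N => c * totalDeviation r N) (countLaw (s n) θstar) :=
    hT.1.const_mul c
  have hQi : Integrable Q (countLaw (s n) θstar) := hSi.add hTc
  have hQ : ∫ N, Q N ∂(countLaw (s n) θstar) ≤ C * Real.sqrt n + c * (2 * n) := by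
    simp only [Q]
    rw [integral_add hSi hTc, integral_const_mul]
    exact add_le_add hS.2 (mul_le_mul_of_nonneg_left hT.2 hc0.le)
  have hQ0 (N : Fin n → ℕ) : 0 ≤ Q N :=
    add_nonneg (norm_nonneg _) (mul_nonneg hc0.le (Finset.sum_nonneg fun i _ => abs_nonneg _))
  have hmarkov : (countLaw (s n) θstar).real {N | a * n / (2 * K) ≤ Q N}
      ≤ (C * Real.sqrt n + c * (2 * n)) / (a * n / (2 * K)) := by
    rw [le_div_iff₀ (by positivity), mul_comm]
    exact (mul_meas_ge_le_integral_of_nonneg (ae_of_all _ hQ0) hQi _).trans hQ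
  have hsub : {N | a * Real.sqrt n
      < gain (fun i => (s n i θstar : ℝ)) (fun i => (s n i (θhat n N) : ℝ)) N}
      ⊆ {N | K < ‖Real.sqrt n • (θhat n N - θstar)‖} ∪ {N | a * n / (2 * K) ≤ Q N} := by
    intro N hN
    simp only [Set.mem_union, Set.mem_ofPred_eq] at hN ⊢
    by_contra hcon
    rw [not_or, not_lt, not_le] at hcon
    obtain ⟨hA, hBq⟩ := hcon
    rw [norm_smul, Real.norm_eq_abs, abs_of_pos hsn] at hA
    have hδ : ‖θhat n N - θstar‖ ≤ K / Real.sqrt n := by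
      rw [le_div_iff₀ hsn, mul_comm]; exact hA
    have hg := gain_le_of_linearization (r := r) (fun i => hε.trans_le (hr n i)) (hu n N)
      (G := G n) (δ := θhat n N - θstar) (c := c)
      (fun i => hlin n i _ (hδ.trans_lt h2)) N
    have : 2 * ‖θhat n N - θstar‖ * Q N ≤ 2 * (K / Real.sqrt n) * Q N := by
      have := hQ0 N
      gcongr
    have h4 : 2 * (K / Real.sqrt n) * Q N < 2 * (K / Real.sqrt n) * (a * n / (2 * K)) := by
      gcongr
    have e : 2 * (K / Real.sqrt n) * (a * n / (2 * K)) = a * Real.sqrt n := by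
      nth_rw 2 [← Real.mul_self_sqrt hn0.le]
      field_simp
    rw [e] at h4
    exact absurd hN (not_lt.2 ((hg.trans this).trans h4.le))
  have e3 : (C * Real.sqrt n + c * (2 * n)) / (a * n / (2 * K))
      = (2 * K * C / a) / Real.sqrt n + η / 3 := by
    rw [hc]
    nth_rw 2 3 [← Real.mul_self_sqrt hn0.le]
    field_simp
    ring
  calc _ ≤ (countLaw (s n) θstar).real ({N | K < ‖Real.sqrt n • (θhat n N - θstar)‖}
          ∪ {N | a * n / (2 * K) ≤ Q N}) := measureReal_mono hsub
    _ ≤ _ := measureReal_union_le _ _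
    _ ≤ _ := add_le_add le_rfl hmarkov
    _ < η / 3 + (η / 3 + η / 3) := by rw [e3]; linarith
    _ = η := by ring

end Asymptotics

/-- Nonnegative variables that are `o(√n)` in probability are `o(√n)` in `L²` as soon as the
variances of their excesses over `t` are `O(n √P(f > t))`. -/
theorem tendsto_integral_sq_div {Ω : ℕ → Type*} [∀ n, MeasurableSpace (Ω n)]
    {μ : (n : ℕ) → Measure (Ω n)} [∀ n, IsProbabilityMeasure (μ n)] {f : (n : ℕ) → Ω n → ℝ}
    (hf : ∀ n, MemLp (f n) 2 (μ n)) (hfm : ∀ n, Measurable (f n)) (h0 : ∀ n ω, 0 ≤ f n ω)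
    (hprob : ∀ a > 0, Tendsto (fun n : ℕ => (μ n).real {ω | a * Real.sqrt n < f n ω}) atTop (𝓝 0))
    {A : ℝ} (hvar : ∀ n t, Var[fun ω => max (f n ω - t) 0; μ n]
      ≤ A * n * Real.sqrt ((μ n).real {ω | t < f n ω})) :
    Tendsto (fun n : ℕ => (∫ ω, f n ω ^ 2 ∂(μ n)) / n) atTop (𝓝 0) := by
  have hnn (n : ℕ) : 0 ≤ (∫ ω, f n ω ^ 2 ∂(μ n)) / n :=
    div_nonneg (integral_nonneg fun _ => sq_nonneg _) (Nat.cast_nonneg n)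
  refine tendsto_order.2 ⟨fun b hb => Eventually.of_forall fun n => hb.trans_le (hnn n),
    fun b hb => ?_⟩
  set a := Real.sqrt (b / 4) with ha
  have ha0 : 0 < a := Real.sqrt_pos.2 (by positivity)
  have hp := hprob a ha0
  have hlim : Tendsto (fun n : ℕ => 4 * A * Real.sqrt ((μ n).real {ω | a * Real.sqrt n < f n ω}))
      atTop (𝓝 0) := by
    simpa using hp.sqrt.const_mul (4 * A)
  filter_upwards [hp.eventually_lt_const (show (0 : ℝ) < 1 / 2 by norm_num),
    hlim.eventually_lt_const (show 0 < b / 2 by positivity), eventually_gt_atTop 0] with n h1 h2 hn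
  have hn0 : (0 : ℝ) < n := by exact_mod_cast hn
  have h3 := integral_sq_le_of_measure_excess_le (hf n) (hfm n) (h0 n) h1.le
  have h4 := hvar n (a * Real.sqrt n)
  rw [div_lt_iff₀ hn0]
  rw [mul_pow, ha, Real.sq_sqrt (by positivity), Real.sq_sqrt hn0.le] at h3
  rw [← ha] at h3
  nlinarith

end PoissonBins

end

theorem theorem1 (d : ℕ) (Θ : Set (EuclideanSpace ℝ (Fin d))) (θstar : EuclideanSpace ℝ (Fin d))
    (hθstar : θstar ∈ interior Θ)
    -- with `n` bins, the expected count in bin `i` is `s n i θ`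
    (s : (n : ℕ) → Fin n → EuclideanSpace ℝ (Fin d) → ℝ≥0)
    (hsmooth : PoissonBins.UniformlyDifferentiableAt s θstar)
    (hupper : ∃ M : ℝ, ∀ (n : ℕ) (i : Fin n), (s n i θstar : ℝ) ≤ M)
    -- the maximum likelihood estimators
    (θhat : (n : ℕ) → (Fin n → ℕ) → EuclideanSpace ℝ (Fin d))
    (hmle : ∀ n, PoissonBins.IsMLE Θ (s n) (θhat n))
    -- asymptotic normality of the estimators, with the inverse of the limiting information
    (I : Matrix (Fin d) (Fin d) ℝ) (hIpos : I.PosDef)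
    (hI : Tendsto (fun n => PoissonBins.fisherInfo (s n) θstar) atTop (𝓝 I))
    (hnormal : TendstoInDistribution
      (fun (n : ℕ) (N : Fin n → ℕ) => Real.sqrt (n : ℝ) • (θhat n N - θstar)) atTop
      (id : EuclideanSpace ℝ (Fin d) → EuclideanSpace ℝ (Fin d))
      (fun n => PoissonBins.countLaw (s n) θstar) (multivariateGaussian 0 I⁻¹))
    -- uniform lower bound on the rates
    (hlower : ∃ ε : ℝ, 0 < ε ∧ ∀ (n : ℕ) (i : Fin n), ∀ θ ∈ Θ, ε ≤ (s n i θ : ℝ)) :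
    -- (i)
    ((∀ n, MemLp (PoissonBins.cFun (s n) θstar) 2 (PoissonBins.countLaw (s n) θstar)) ∧
      TendstoInDistribution
        (fun (n : ℕ) => PoissonBins.standardize (PoissonBins.cFun (s n) θstar)
          (PoissonBins.countLaw (s n) θstar)) atTop
        (id : ℝ → ℝ) (fun n => PoissonBins.countLaw (s n) θstar) (gaussianReal 0 1)) ∧
    -- (ii)
    ((∀ n, MemLp (fun N => PoissonBins.cFun (s n) (θhat n N) N) 2
        (PoissonBins.countLaw (s n) θstar)) ∧
      TendstoInDistribution
        (fun (n : ℕ) => PoissonBins.standardize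
          (fun N => PoissonBins.cFun (s n) (θhat n N) N)
          (PoissonBins.countLaw (s n) θstar)) atTop
        (id : ℝ → ℝ) (fun n => PoissonBins.countLaw (s n) θstar) (gaussianReal 0 1)) := by
  obtain ⟨M, hM⟩ := hupper
  obtain ⟨ε, hε, hlow⟩ := hlower
  have hmem : θstar ∈ Θ := interior_subset hθstar
  have hr n i : ε ≤ s n i θstar := hlow n i θstar hmem
  have hu n N i : ε ≤ s n i (θhat n N) := hlow n i _ (hmle n N).1
  have hr0 n i : (0 : ℝ) < s n i θstar := hε.trans_le (hr n i)
  have hu0 n N i : (0 : ℝ) < s n i (θhat n N) := hε.trans_le (hu n N i)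
  have hpos n i θ (hθ : θ ∈ Θ) : (0 : ℝ) < s n i θ := hε.trans_le (hlow n i θ hθ)
  have hX n : MemLp (PoissonBins.cFun (s n) θstar) 2 (PoissonBins.countLaw (s n) θstar) :=
    PoissonBins.memLp_cFun hε (hr n) (hM n)
  have hle n N : PoissonBins.cFun (s n) (θhat n N) N ≤ PoissonBins.cFun (s n) θstar N :=
    (hmle n).cFun_le (hpos n) hmem N
  have hY n : MemLp (fun N => PoissonBins.cFun (s n) (θhat n N) N) 2
      (PoissonBins.countLaw (s n) θstar) := by
    refine (hX n).mono .of_discrete (ae_of_all _ fun N => ?_)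
    rw [Real.norm_of_nonneg (PoissonBins.cFun_nonneg (hu0 n N) N),
      Real.norm_of_nonneg (PoissonBins.cFun_nonneg (hr0 n) N)]
    exact hle n N
  set c := Real.exp (-M) * min 1 (min ε (ε ^ 2 / 2)) * ((4 * Real.log 2) ^ 2 / 6) with hc
  have hc0 : 0 < c := by
    have := Real.log_pos one_lt_two
    positivity
  have hclt : TendstoInDistribution
      (fun (n : ℕ) => PoissonBins.standardize (PoissonBins.cFun (s n) θstar)
        (PoissonBins.countLaw (s n) θstar)) atTop
      (id : ℝ → ℝ) (fun n => PoissonBins.countLaw (s n) θstar) (gaussianReal 0 1) := by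
    have h := PoissonBins.tendstoInDistribution_standardize_sum
      (fun n i => poissonMeasure (s n i θstar))
      (fun n i k => 2 * PoissonBins.binDeviance (s n i θstar) k)
      (fun n i => PoissonBins.memLp_binDeviance hε (hr n i) (hM n i)) hc0
      (fun n i => PoissonBins.le_variance_binDeviance hε (hr n i) (hM n i))
      (fun n i => (PoissonBins.third_moment_binDeviance_le hε (hr n i) (hM n i) rfl).1)
      (fun n i => (PoissonBins.third_moment_binDeviance_le hε (hr n i) (hM n i) rfl).2)
    simp_rw [← PoissonBins.cFun_eq_sum_binDeviance] at h
    exact h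
  refine ⟨⟨hX, hclt⟩, hY, ?_⟩
  have hD n N : PoissonBins.cFun (s n) θstar N - PoissonBins.cFun (s n) (θhat n N) N
      = PoissonBins.gain (fun i => (s n i θstar : ℝ)) (fun i => (s n i (θhat n N) : ℝ)) N :=
    PoissonBins.cFun_sub_cFun (hr0 n) (hu0 n N) N
  have hD0 n N : 0 ≤ PoissonBins.gain (fun i => (s n i θstar : ℝ))
      (fun i => (s n i (θhat n N) : ℝ)) N := by
    rw [← hD]; linarith [hle n N]
  have hDL n : MemLp (fun N => PoissonBins.gain (fun i => (s n i θstar : ℝ))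
      (fun i => (s n i (θhat n N) : ℝ)) N) 2 (PoissonBins.countLaw (s n) θstar) := by
    simp_rw [← hD]
    exact (hX n).sub (hY n)
  have hmax n (N N' : Fin n → ℕ) : PoissonBins.gain (fun i => (s n i θstar : ℝ))
      (fun i => (s n i (θhat n N') : ℝ)) N ≤ PoissonBins.gain (fun i => (s n i θstar : ℝ))
      (fun i => (s n i (θhat n N) : ℝ)) N := by
    rw [← hD, ← PoissonBins.cFun_sub_cFun (hr0 n) (hu0 n N')]
    linarith [(hmle n).cFun_le (hpos n) (hmle n N').1 N]
  have hL2 := PoissonBins.tendsto_integral_sq_div (μ := fun n => PoissonBins.countLaw (s n) θstar)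
    hDL (fun n => .of_discrete) hD0
    (fun a ha => PoissonBins.tendsto_measure_gain_gt hsmooth hε hr hM hu0
      (fun η hη => exists_measure_norm_gt_lt hnormal hη) ha)
    (fun n t => PoissonBins.variance_excess_gain_le hε (hr n) (hM n) (hu n) (hmax n) (hD0 n)
      (hDL n) t)
  have hV n : n * c ≤ Var[PoissonBins.cFun (s n) θstar; PoissonBins.countLaw (s n) θstar] := by
    have e : PoissonBins.cFun (s n) θstar = ∑ i, fun N : Fin n → ℕ =>
        2 * PoissonBins.binDeviance (s n i θstar) (N i) := by
      ext N
      simp [PoissonBins.cFun_eq_sum_binDeviance]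
    have h := variance_sum_pi (X := fun i k => 2 * PoissonBins.binDeviance (s n i θstar) k)
      fun i => PoissonBins.memLp_binDeviance hε (hr n i) (hM n i)
    rw [e, PoissonBins.countLaw, h]
    simpa using Finset.card_nsmul_le_sum Finset.univ (fun i => Var[fun k =>
      2 * PoissonBins.binDeviance (s n i θstar) k; poissonMeasure (s n i θstar)]) c
      fun i _ => PoissonBins.le_variance_binDeviance hε (hr n i) (hM n i)
  have hVpos : ∀ᶠ n : ℕ in atTop,
      0 < Var[PoissonBins.cFun (s n) θstar; PoissonBins.countLaw (s n) θstar] := by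
    filter_upwards [eventually_gt_atTop 0] with n hn
    have hn0 : (0 : ℝ) < n := by exact_mod_cast hn
    exact (mul_pos hn0 hc0).trans_le (hV n)
  refine PoissonBins.tendstoInDistribution_standardize_of_sub hX hY hVpos ?_ hclt
  simp_rw [hD]
  refine squeeze_zero' (Eventually.of_forall fun n =>
    div_nonneg (integral_nonneg fun _ => sq_nonneg _) (variance_nonneg _ _)) ?_
    (by simpa using hL2.div_const c)
  filter_upwards [eventually_gt_atTop 0] with n hn
  have hn0 : (0 : ℝ) < n := by exact_mod_cast hn
  rw [div_div]
  exact div_le_div_of_nonneg_left (integral_nonneg fun _ => sq_nonneg _) (mul_pos hn0 hc0) (hV n)
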